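/- Index conventions. An index is a finite, possibly empty, sequence $\mathbf k=(k_1,\dots,k_r)$ of positive integers, with weight $\mathrm{wt}(\mathbf k)=k_1+\cdots+k_r$; let $I$ be the set of indices. Let $$\mathcal A=\Big(\prod_p \mathbb F_p\Big)\Big/\Big(\bigoplus_p\mathbb F_p\Big),\qquad \mathcal B=\Big(\prod_p \mathbb F_p[T]\Big)\Big/\Big(\bigoplus_p\mathbb F_p[T]\Big),$$ where $p$ runs over all primes; these are $\mathbb Q$-algebras, and $\mathcal A\subset\mathcal B$ via constant polynomials. For an index $\mathbf k$ define $\zeta_{\mathcal A}(\mathbf k)\in\mathcal A$ and $\mathrm{li}_{\mathbf k}(T)\in\mathcal B$ by the $p$-components $$\zeta_{\mathcal A}(\mathbf k)=\sum_{\substack{l_1,\dots,l_r\ge1\\ l_1+\cdots+l_r<p}}\frac1{l_1^{k_1}(l_1+l_2)^{k_2}\cdots(l_1+\cdots+l_r)^{k_r}},\qquad \mathrm{li}_{\mathbf k}(T)=\mathop{{\sum}'}_{0<l_1,\dots,l_r<p}\frac{T^{l_1+\cdots+l_r}}{l_1^{k_1}(l_1+l_2)^{k_2}\cdots(l_1+\cdots+l_r)^{k_r}},$$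 where $\sum'$ means that only the terms with denominator prime to $p$ are taken; both are $1$ for $\mathbf k=\emptyset$. Let $T^p\in\mathcal B$ be the element whose $p$-component is $T^p$. For integers $a\ge b\ge0$ let $\mathcal R_{a,b}\subset\mathcal B$ be the $\mathbb Q$-span of all $\zeta_{\mathcal A}(\mathbf k)(T^p)^n\,\mathrm{li}_{\mathbf k'}(T)$ with $n\ge0$, $\mathrm{wt}(\mathbf k)+\mathrm{wt}(\mathbf k')=a$ and $\mathrm{wt}(\mathbf k')\le b$, and put $\mathcal R_{a,-1}=0$. Stuffle product. On formal $\mathbb Q$-linear combinations of indices, $*$ is the bilinear product with $\emptyset*\mathbf k=\mathbf k*\emptyset=\mathbf k$ and $(k,\mathbf k)*(l,\mathbf l)=(k,\mathbf k*(l,\mathbf l))+(l,(k,\mathbf k)*\mathbf l)+(k+l,\mathbf k*\mathbf l)$. Shuffle product. On $\mathbb Q\langle x,y\rangle$, let $\mathbin{\mathrm{sh}}$ be the bilinear product with $1\mathbin{\mathrm{sh}}w=w\mathbin{\mathrm{sh}}1=w$ and $(u_1w_1)\mathbin{\mathrm{sh}}(u_2w_2)=u_1(w_1\mathbin{\mathrm{sh}}u_2w_2)+u_2(u_1w_1\mathbin{\mathrm{sh}}w_2)$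 for $u_1,u_2\in\{x,y\}$. Put $z_k=x^{k-1}y$ and attach to $\mathbf k=(k_1,\dots,k_r)$ the word $z_{\mathbf k}=z_{k_r}z_{k_{r-1}}\cdots z_{k_1}$. Then $\mathbf k\mathbin{\mathrm{sh}}\mathbf k'$ is the formal linear combination of indices corresponding to $z_{\mathbf k}\mathbin{\mathrm{sh}}z_{\mathbf k'}$. For instance $(2)\mathbin{\mathrm{sh}}(3)=(3,2)+3\,(2,3)+6\,(1,4)$. Let $\mathcal S=\bigoplus_{\mathbf k,\mathbf k'\in I}\mathbb Q\,u_{\mathbf k}v_{\mathbf k'}$ be the $\mathbb Q$-algebra with product $(u_{\mathbf k_1}v_{\mathbf k_1'})\cdot(u_{\mathbf k_2}v_{\mathbf k_2'})=u_{\mathbf k_1*\mathbf k_2}\,v_{\mathbf k_1'\mathbin{\mathrm{sh}}\mathbf k_2'}$ (the subscripts extended linearly) and unit $u_\emptyset v_\emptyset$. Statement. One has $\mathcal R_{a_1,b_1}\cdot\mathcal R_{a_2,b_2}\subset\mathcal R_{a_1+a_2,b_1+b_2}$ for all $a_1\ge b_1\ge0$ and $a_2\ge b_2\ge0$, so that $$\overline{\mathcal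 R}=\bigoplus_{a\ge b\ge0}\mathcal R_{a,b}/\mathcal R_{a,b-1}$$ is a $\mathbb Q$-algebra under the product induced by that of $\mathcal B$; and the $\mathbb Q$-linear map $\varphi:\mathcal S\to\overline{\mathcal R}$ which sends $u_{\mathbf k}v_{\mathbf k'}$ to the class of $\zeta_{\mathcal A}(\mathbf k)\,\mathrm{li}_{\mathbf k'}(T)$ in $\mathcal R_{a,b}/\mathcal R_{a,b-1}$, with $a=\mathrm{wt}(\mathbf k)+\mathrm{wt}(\mathbf k')$ and $b=\mathrm{wt}(\mathbf k')$, is a homomorphism of $\mathbb Q$-algebras. -/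

import Mathlib

namespace FMP

/-! ### Indices and words -/

/-- An index: a finite (possibly empty) sequence of positive integers. -/
abbrev Index : Type := List ℕ+

/-- The weight `k₁ + ⋯ + k_r` of an index. -/
def wt (k : Index) : ℕ := (k.map fun i : ℕ+ => (i : ℕ)).sum

/-! ### Bilinear products on free vector spaces -/

section Bilinear

variable {X : Type}

/-- The bilinear extension to `X →₀ ℚ` of a product of basis elements. -/
noncomputable def bilin (m : X → X → (X →₀ ℚ)) : (X →₀ ℚ) →ₗ[ℚ] (X →₀ ℚ) →ₗ[ℚ] (X →₀ ℚ) :=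
  Finsupp.linearCombination ℚ fun u => Finsupp.linearCombination ℚ fun v => m u v

theorem bilin_single (m : X → X → (X →₀ ℚ)) (u v : X) :
    bilin m (Finsupp.single u 1) (Finsupp.single v 1) = m u v := by
  simp [bilin]

theorem bilin_comm (m : X → X → (X →₀ ℚ)) (hm : ∀ u v, m u v = m v u) (f g : X →₀ ℚ) :
    bilin m f g = bilin m g f := by
  have : bilin m = (bilin m).flip := by
    ext u v : 4
    simp [bilin, hm u v]
  exact LinearMap.congr_fun₂ this f g

theorem bilin_one (m : X → X → (X →₀ ℚ)) (e : X) (hm : ∀ u, m e u = Finsupp.single u 1)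
    (f : X →₀ ℚ) : bilin m (Finsupp.single e 1) f = f := by
  have : bilin m (Finsupp.single e 1) = LinearMap.id := by
    ext u : 2
    simp [bilin, hm u]
  rw [this]; rfl

theorem bilin_assoc (m : X → X → (X →₀ ℚ))
    (hm : ∀ u v w, bilin m (m u v) (Finsupp.single w 1) = bilin m (Finsupp.single u 1) (m v w))
    (f g h : X →₀ ℚ) : bilin m (bilin m f g) h = bilin m f (bilin m g h) := by
  have : (bilin m).compr₂ (bilin m) =
      (LinearMap.lcomp ℚ _ (bilin m)).comp ((LinearMap.llcomp ℚ _ _ _).comp (bilin m)) := by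
    ext u v w : 6
    simpa [bilin_single] using hm u v w
  have h2 := LinearMap.congr_fun (LinearMap.congr_fun₂ this f g) h
  simpa using h2

/-- The commutative ring on `X →₀ ℚ` with the given product of basis elements. -/
@[reducible] noncomputable def ringOfBilin (m : X → X → (X →₀ ℚ)) (e : X)
    (hc : ∀ u v, m u v = m v u) (h1 : ∀ u, m e u = Finsupp.single u 1)
    (ha : ∀ u v w,
      bilin m (m u v) (Finsupp.single w 1) = bilin m (Finsupp.single u 1) (m v w)) :
    CommRing (X →₀ ℚ) :=
  { (inferInstance : AddCommGroup (X →₀ ℚ)) with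
    mul := fun f g => bilin m f g
    one := Finsupp.single e 1
    left_distrib := fun f g h => map_add (bilin m f) g h
    right_distrib := fun f g h => LinearMap.map_add₂ (bilin m) f g h
    zero_mul := fun f => LinearMap.map_zero₂ (bilin m) f
    mul_zero := fun f => map_zero (bilin m f)
    mul_assoc := bilin_assoc m ha
    one_mul := bilin_one m e h1
    mul_one := fun f => (bilin_comm m hc _ _).trans (bilin_one m e h1 f)
    mul_comm := bilin_comm m hc }

end Bilinear

section QuasiShuffle

variable {α : Type}

/-- Concatenation of a letter on the left, extended linearly to combinations of words. -/
noncomputable def prepend (a : α) : (List α →₀ ℚ) →ₗ[ℚ] (List α →₀ ℚ) :=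
  Finsupp.lmapDomain ℚ ℚ (List.cons a)

@[simp] theorem prepend_single (a : α) (u : List α) (c : ℚ) :
    prepend a (Finsupp.single u c) = Finsupp.single (a :: u) c := by
  simp [prepend]

variable (m : List α → List α → (List α →₀ ℚ)) (op : α → α → α) (c : ℚ)

theorem quasi_comm (h0 : ∀ w, m [] w = Finsupp.single w 1)
    (h0' : ∀ w, m w [] = Finsupp.single w 1)
    (hm : ∀ a u b v, m (a :: u) (b :: v) =
      prepend a (m u (b :: v)) + prepend b (m (a :: u) v) + c • prepend (op a b) (m u v))
    (hop : ∀ a b, op a b = op b a) : ∀ u v, m u v = m v u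
  | [], v => by rw [h0, h0']
  | a :: u, [] => by rw [h0, h0']
  | a :: u, b :: v => by
    rw [hm, hm, quasi_comm h0 h0' hm hop u (b :: v), quasi_comm h0 h0' hm hop (a :: u) v,
      quasi_comm h0 h0' hm hop u v, hop a b, add_comm (prepend a _)]
  termination_by u v => u.length + v.length

theorem quasi_prepend
    (hm : ∀ a u b v, m (a :: u) (b :: v) =
      prepend a (m u (b :: v)) + prepend b (m (a :: u) v) + c • prepend (op a b) (m u v))
    (a b : α) (f g : List α →₀ ℚ) :
    bilin m (prepend a f) (prepend b g) =
      prepend a (bilin m f (prepend b g)) + prepend b (bilin m (prepend a f) g) +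
        c • prepend (op a b) (bilin m f g) := by
  induction f using Finsupp.induction_linear with
  | zero => simp
  | add f f' hf hf' => simp only [map_add, LinearMap.add_apply, hf, hf', smul_add]; abel
  | single u r =>
    induction g using Finsupp.induction_linear with
    | zero => simp
    | add g g' hg hg' => simp only [map_add, hg, hg', smul_add]; abel
    | single v s =>
      have e1 : ∀ (w : List α) (t : ℚ), Finsupp.single w t = t • Finsupp.single w 1 := by simp
      rw [e1 u r, e1 v s]
      simp only [map_smul, LinearMap.smul_apply, prepend_single, bilin_single, hm, smul_add,
        smul_comm c]

theorem quasi_assoc (h0 : ∀ w, m [] w = Finsupp.single w 1)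
    (h0' : ∀ w, m w [] = Finsupp.single w 1)
    (hm : ∀ a u b v, m (a :: u) (b :: v) =
      prepend a (m u (b :: v)) + prepend b (m (a :: u) v) + c • prepend (op a b) (m u v))
    (hop : ∀ a b, op a b = op b a) (hop' : ∀ a b d, op (op a b) d = op a (op b d)) :
    ∀ u v w, bilin m (m u v) (Finsupp.single w 1) = bilin m (Finsupp.single u 1) (m v w)
  | [], v, w => by rw [h0, bilin_single, bilin_one m [] h0]
  | a :: u, [], w => by rw [h0, h0', bilin_single]
  | a :: u, b :: v, [] => by
    rw [h0', bilin_single, bilin_comm m (quasi_comm m op c h0 h0' hm hop), bilin_one m [] h0]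
  | a :: u, b :: v, d :: w => by
    have i1 := quasi_assoc h0 h0' hm hop hop' u (b :: v) (d :: w)
    have i2 := quasi_assoc h0 h0' hm hop hop' (a :: u) v (d :: w)
    have i3 := quasi_assoc h0 h0' hm hop hop' (a :: u) (b :: v) w
    have i4 := quasi_assoc h0 h0' hm hop hop' u v (d :: w)
    have i5 := quasi_assoc h0 h0' hm hop hop' u (b :: v) w
    have i6 := quasi_assoc h0 h0' hm hop hop' (a :: u) v w
    have i7 := quasi_assoc h0 h0' hm hop hop' u v w
    have key := quasi_prepend m op c hm
    have es : ∀ (x : α) (y : List α),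
        (Finsupp.single (x :: y) 1 : List α →₀ ℚ) = prepend x (Finsupp.single y 1) := by simp
    have hL : bilin m (m (a :: u) (b :: v)) (Finsupp.single (d :: w) 1) =
        prepend a (bilin m (m u (b :: v)) (Finsupp.single (d :: w) 1)) +
        prepend b (bilin m (m (a :: u) v) (Finsupp.single (d :: w) 1)) +
        prepend d (bilin m (m (a :: u) (b :: v)) (Finsupp.single w 1)) +
        c • prepend (op a b) (bilin m (m u v) (Finsupp.single (d :: w) 1)) +
        c • prepend (op a d) (bilin m (m u (b :: v)) (Finsupp.single w 1)) +
        c • prepend (op b d) (bilin m (m (a :: u) v) (Finsupp.single w 1)) +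
        (c * c) • prepend (op a (op b d)) (bilin m (m u v) (Finsupp.single w 1)) := by
      simp only [hm a u b v, es d w, map_add, map_smul, LinearMap.add_apply,
        LinearMap.smul_apply, key, hop']
      module
    have hR : bilin m (Finsupp.single (a :: u) 1) (m (b :: v) (d :: w)) =
        prepend a (bilin m (Finsupp.single u 1) (m (b :: v) (d :: w))) +
        prepend b (bilin m (Finsupp.single (a :: u) 1) (m v (d :: w))) +
        prepend d (bilin m (Finsupp.single (a :: u) 1) (m (b :: v) w)) +
        c • prepend (op a b) (bilin m (Finsupp.single u 1) (m v (d :: w))) +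
        c • prepend (op a d) (bilin m (Finsupp.single u 1) (m (b :: v) w)) +
        c • prepend (op b d) (bilin m (Finsupp.single (a :: u) 1) (m v w)) +
        (c * c) • prepend (op a (op b d)) (bilin m (Finsupp.single u 1) (m v w)) := by
      simp only [hm b v d w, es a u, map_add, map_smul, key]
      module
    rw [hL, hR, i1, i2, i3, i4, i5, i6, i7]
  termination_by u v w => u.length + v.length + w.length

end QuasiShuffle

/-! ### The stuffle algebra -/

/-- The stuffle product `k * l` of two indices, as a formal `ℚ`-linear combination of indices. -/
noncomputable def stuffle : Index → Index → (Index →₀ ℚ)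
  | [], w => Finsupp.single w 1
  | a :: u, [] => Finsupp.single (a :: u) 1
  | a :: u, b :: v =>
    prepend a (stuffle u (b :: v)) + prepend b (stuffle (a :: u) v) + prepend (a + b) (stuffle u v)
  termination_by u v => u.length + v.length

theorem stuffle_nil_left (w : Index) : stuffle [] w = Finsupp.single w 1 := by
  rw [stuffle]

theorem stuffle_nil_right (w : Index) : stuffle w [] = Finsupp.single w 1 := by
  cases w <;> rw [stuffle]

theorem stuffle_cons (a : ℕ+) (u : Index) (b : ℕ+) (v : Index) :
    stuffle (a :: u) (b :: v) = prepend a (stuffle u (b :: v)) + prepend b (stuffle (a :: u) v) +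
      (1 : ℚ) • prepend (a + b) (stuffle u v) := by
  rw [stuffle, one_smul]

/-- The `ℚ`-vector space with basis `u_k` (`k` an index), with the stuffle product. -/
def StuffleAlg : Type := Index →₀ ℚ

noncomputable instance : CommRing StuffleAlg :=
  letI : CommRing (Index →₀ ℚ) := ringOfBilin stuffle []
    (quasi_comm stuffle (· + ·) 1 stuffle_nil_left stuffle_nil_right stuffle_cons add_comm)
    stuffle_nil_left
    (quasi_assoc stuffle (· + ·) 1 stuffle_nil_left stuffle_nil_right stuffle_cons add_comm
      add_assoc)
  inferInstanceAs (CommRing (Index →₀ ℚ))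

noncomputable instance : Algebra ℚ StuffleAlg :=
  letI : Module ℚ StuffleAlg := inferInstanceAs (Module ℚ (Index →₀ ℚ))
  Algebra.ofModule (fun r f g => LinearMap.map_smul₂ (bilin stuffle) r f g)
    (fun r f g => map_smul (bilin stuffle f) r g)

/-- The basis `(u_k)` of the stuffle algebra. -/
noncomputable def StuffleAlg.u : Module.Basis Index ℚ StuffleAlg :=
  Module.Basis.ofRepr (LinearEquiv.refl ℚ (Index →₀ ℚ))

/-! ### The shuffle algebra -/

/-- The two letters of the noncommutative polynomial ring `ℚ⟨x, y⟩`. -/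
inductive Letter : Type
  | x
  | y

/-- The shuffle product of two words in `x` and `y`, an element of `ℚ⟨x, y⟩`, which is regarded as
the vector space with basis the words. -/
noncomputable def shuffleWord : List Letter → List Letter → (List Letter →₀ ℚ)
  | [], w => Finsupp.single w 1
  | a :: u, [] => Finsupp.single (a :: u) 1
  | a :: u, b :: v => prepend a (shuffleWord u (b :: v)) + prepend b (shuffleWord (a :: u) v)
  termination_by u v => u.length + v.length

theorem shuffleWord_nil_left (w : List Letter) : shuffleWord [] w = Finsupp.single w 1 := by
  rw [shuffleWord]

theorem shuffleWord_nil_right (w : List Letter) : shuffleWord w [] = Finsupp.single w 1 := by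
  cases w <;> rw [shuffleWord]

theorem shuffleWord_cons (a : Letter) (u : List Letter) (b : Letter) (v : List Letter) :
    shuffleWord (a :: u) (b :: v) =
      prepend a (shuffleWord u (b :: v)) + prepend b (shuffleWord (a :: u) v) := by
  rw [shuffleWord]

theorem shuffleWord_comm : ∀ u v, shuffleWord u v = shuffleWord v u :=
  quasi_comm shuffleWord (fun _ _ => Letter.x) 0 shuffleWord_nil_left shuffleWord_nil_right
    (fun a u b v => by rw [shuffleWord_cons, zero_smul, add_zero]) (fun _ _ => rfl)

theorem shuffleWord_assoc (u v w : List Letter) :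
    bilin shuffleWord (shuffleWord u v) (Finsupp.single w 1) =
      bilin shuffleWord (Finsupp.single u 1) (shuffleWord v w) :=
  quasi_assoc shuffleWord (fun _ _ => Letter.x) 0 shuffleWord_nil_left shuffleWord_nil_right
    (fun a u b v => by rw [shuffleWord_cons, zero_smul, add_zero]) (fun _ _ => rfl)
    (fun _ _ _ => rfl) u v w

/-- The word `z_k = x ^ (k - 1) y`. -/
def z (k : ℕ+) : List Letter := List.replicate (k - 1 : ℕ) Letter.x ++ [Letter.y]

/-- The word `z_{k_r} ⋯ z_{k_1}` attached to the index `k = (k_1, …, k_r)`: the exponent `k_r`, which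
belongs to the outermost sum `l_1 + ⋯ + l_r` of a multiple polylogarithm, comes first. -/
def indexWord (k : Index) : List Letter := (k.reverse.map z).flatten

theorem indexWord_cons (a : ℕ+) (k : Index) : indexWord (a :: k) = indexWord k ++ z a := by
  simp [indexWord]

/-- Decoding of a word, with `n` letters `x` already read. -/
def decode : ℕ → List Letter → Index
  | _, [] => []
  | n, Letter.x :: w => decode (n + 1) w
  | n, Letter.y :: w => decode 0 w ++ [n.succPNat]

theorem decode_replicate (n j : ℕ) (w : List Letter) :
    decode n (List.replicate j Letter.x ++ w) = decode (n + j) w := by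
  induction j generalizing n with
  | zero => simp
  | succ j ih => rw [List.replicate_succ, List.cons_append, decode, ih]; congr 1; omega

theorem decode_z (k : ℕ+) (w : List Letter) : decode 0 (z k ++ w) = decode 0 w ++ [k] := by
  rw [z, List.append_assoc, decode_replicate, List.singleton_append, decode]
  congr 2
  apply PNat.eq
  have := k.pos
  simp only [Nat.succPNat_coe]
  omega

theorem decode_indexWord (k : Index) : decode 0 (indexWord k) = k := by
  have : ∀ l : List ℕ+, decode 0 ((l.map z).flatten) = l.reverse := by
    intro l
    induction l with
    | nil => simp [decode]
    | cons a l ih => simp [decode_z, ih]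
  simpa [indexWord] using this k.reverse

theorem indexWord_injective : Function.Injective indexWord :=
  Function.LeftInverse.injective decode_indexWord

theorem indexWord_decode (n : ℕ) (w : List Letter) (hw : w.getLast? = some Letter.y) :
    indexWord (decode n w) = List.replicate n Letter.x ++ w := by
  induction w generalizing n with
  | nil => simp at hw
  | cons a w ih =>
    have key : w = [] ∨ w.getLast? = some Letter.y := by
      rcases List.eq_nil_or_concat w with rfl | ⟨w', b, rfl⟩
      · exact Or.inl rfl
      · right
        rw [List.concat_eq_append, ← List.cons_append, List.getLast?_append] at hw
        simpa using hw
    cases a with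
    | x =>
      rcases key with rfl | h
      · simp at hw
      · rw [decode, ih _ h, List.replicate_succ']; simp
    | y =>
      have e : indexWord (decode 0 w) = w := by
        rcases key with rfl | h
        · simp [decode, indexWord]
        · simpa using ih 0 h
      have e2 : ∀ k : Index, indexWord (k ++ [n.succPNat]) = z n.succPNat ++ indexWord k := by
        intro k; simp [indexWord]
      rw [decode, e2, e]
      simp [z]

/-- The shuffle product `k sh l` of two indices, as a formal `ℚ`-linear combination of indices: the
coefficient of the index `m` is the coefficient of the word of `m` in the shuffle product of the
words of `k` and `l`. -/
noncomputable def shuffle (k l : Index) : Index →₀ ℚ :=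
  Finsupp.comapDomain indexWord (shuffleWord (indexWord k) (indexWord l))
    indexWord_injective.injOn

/-- Words that are empty or end in the letter `y`. -/
def Good (w : List Letter) : Prop := w = [] ∨ w.getLast? = some Letter.y

theorem good_indexWord (k : Index) : Good (indexWord k) := by
  cases k with
  | nil => left; rfl
  | cons a k => right; rw [indexWord_cons]; simp [z]

theorem Good.exists_index {w : List Letter} (hw : Good w) : ∃ k, indexWord k = w := by
  rcases hw with rfl | h
  · exact ⟨[], rfl⟩
  · exact ⟨decode 0 w, by simpa using indexWord_decode 0 w h⟩

theorem shuffleWord_support (u v : List Letter) : Good u → Good v →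
    ∀ w ∈ (shuffleWord u v).support, Good w ∧ w.length = u.length + v.length := by
  classical
  have tail : ∀ (a : Letter) (u : List Letter), Good (a :: u) → Good u := by
    intro a u h
    rcases List.eq_nil_or_concat u with rfl | ⟨u', b, rfl⟩
    · exact Or.inl rfl
    · right
      rcases h with h | h
      · simp at h
      · rw [List.concat_eq_append, ← List.cons_append, List.getLast?_append] at h
        simpa using h
  have cons : ∀ (a : Letter) (u : List Letter), u ≠ [] → Good u → Good (a :: u) := by
    intro a u h0 h
    rcases List.eq_nil_or_concat u with rfl | ⟨u', b, rfl⟩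
    · exact absurd rfl h0
    · right
      rcases h with h | h
      · simp at h
      · rw [List.concat_eq_append, ← List.cons_append, List.getLast?_append]
        simpa using h
  have supp : ∀ (a : Letter) (f : List Letter →₀ ℚ) (w : List Letter),
      w ∈ (prepend a f).support → ∃ w' ∈ f.support, w = a :: w' := by
    intro a f w hw
    have := Finsupp.mapDomain_support hw
    rw [Finset.mem_image] at this
    obtain ⟨w', h1, h2⟩ := this
    exact ⟨w', h1, h2.symm⟩
  induction u, v using shuffleWord.induct with
  | case1 w =>
    intro _ hv w' hw'
    rw [shuffleWord_nil_left] at hw'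
    have := Finsupp.support_single_subset hw'
    rw [Finset.mem_singleton] at this
    subst this
    simpa using hv
  | case2 a u =>
    intro hu _ w' hw'
    rw [shuffleWord_nil_right] at hw'
    have := Finsupp.support_single_subset hw'
    rw [Finset.mem_singleton] at this
    subst this
    simpa using hu
  | case3 a u b v ih1 ih2 =>
    intro hu hv w hw
    rw [shuffleWord_cons] at hw
    rcases Finset.mem_union.mp (Finsupp.support_add hw) with h | h
    · obtain ⟨w', h1, rfl⟩ := supp _ _ _ h
      obtain ⟨g, hl⟩ := ih1 (tail _ _ hu) hv w' h1
      refine ⟨cons _ _ ?_ g, ?_⟩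
      · rintro rfl; simp at hl; try omega
      · simp [hl]; omega
    · obtain ⟨w', h1, rfl⟩ := supp _ _ _ h
      obtain ⟨g, hl⟩ := ih2 hu (tail _ _ hv) w' h1
      refine ⟨cons _ _ ?_ g, ?_⟩
      · rintro rfl; simp at hl; try omega
      · simp [hl]; omega

/-- Under `k ↦ z_k`, the shuffle product of indices is the shuffle product of words. -/
theorem mapDomain_shuffle (k l : Index) :
    Finsupp.mapDomain indexWord (shuffle k l) = shuffleWord (indexWord k) (indexWord l) := by
  apply Finsupp.mapDomain_comapDomain _ indexWord_injective
  intro w hw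
  obtain ⟨m, hm⟩ :=
    (shuffleWord_support _ _ (good_indexWord k) (good_indexWord l) w hw).1.exists_index
  exact ⟨m, hm⟩

theorem mapDomain_bilin_shuffle (f g : Index →₀ ℚ) :
    Finsupp.lmapDomain ℚ ℚ indexWord (bilin shuffle f g) =
      bilin shuffleWord (Finsupp.lmapDomain ℚ ℚ indexWord f)
        (Finsupp.lmapDomain ℚ ℚ indexWord g) := by
  have : (bilin shuffle).compr₂ (Finsupp.lmapDomain ℚ ℚ indexWord) =
      (bilin shuffleWord).compl₁₂ (Finsupp.lmapDomain ℚ ℚ indexWord)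
        (Finsupp.lmapDomain ℚ ℚ indexWord) := by
    ext k l : 4
    simp [bilin_single, mapDomain_shuffle]
  exact LinearMap.congr_fun₂ this f g

theorem lmapDomain_indexWord_injective :
    Function.Injective (Finsupp.lmapDomain ℚ ℚ indexWord) :=
  Finsupp.mapDomain_injective indexWord_injective

theorem shuffle_comm (k l : Index) : shuffle k l = shuffle l k := by
  simp only [shuffle, shuffleWord_comm (indexWord k)]

theorem shuffle_nil_left (k : Index) : shuffle [] k = Finsupp.single k 1 := by
  apply lmapDomain_indexWord_injective
  simp [mapDomain_shuffle, indexWord, shuffleWord_nil_left]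

theorem shuffle_assoc (k l m : Index) :
    bilin shuffle (shuffle k l) (Finsupp.single m 1) =
      bilin shuffle (Finsupp.single k 1) (shuffle l m) := by
  apply lmapDomain_indexWord_injective
  simp only [mapDomain_bilin_shuffle]
  simp [mapDomain_shuffle, shuffleWord_assoc]

/-- The `ℚ`-vector space with basis `v_k` (`k` an index), with the shuffle product. -/
def ShuffleAlg : Type := Index →₀ ℚ

noncomputable instance : CommRing ShuffleAlg :=
  letI : CommRing (Index →₀ ℚ) := ringOfBilin shuffle [] shuffle_comm shuffle_nil_left shuffle_assoc
  inferInstanceAs (CommRing (Index →₀ ℚ))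

noncomputable instance : Algebra ℚ ShuffleAlg :=
  letI : Module ℚ ShuffleAlg := inferInstanceAs (Module ℚ (Index →₀ ℚ))
  Algebra.ofModule (fun r f g => LinearMap.map_smul₂ (bilin shuffle) r f g)
    (fun r f g => map_smul (bilin shuffle f) r g)

/-- The basis `(v_k)` of the shuffle algebra. -/
noncomputable def ShuffleAlg.v : Module.Basis Index ℚ ShuffleAlg :=
  Module.Basis.ofRepr (LinearEquiv.refl ℚ (Index →₀ ℚ))

/-! ### The stuffle-shuffle algebra -/

open scoped TensorProduct

/-- The stuffle-shuffle algebra: its basis is formed by the products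
`u_k v_l = u_k ⊗ v_l`, and `(u_k v_l) (u_k' v_l') = (u_k * u_k') (v_l sh v_l')`. -/
abbrev StuffleShuffle : Type := StuffleAlg ⊗[ℚ] ShuffleAlg

/-- The basis `(u_k v_l)` of the stuffle-shuffle algebra. -/
noncomputable def uv : Module.Basis (Index × Index) ℚ StuffleShuffle :=
  StuffleAlg.u.tensorProduct ShuffleAlg.v

/-! ### The rings `𝒜` and `ℬ` -/

section AlmostAll

variable (R : {p : ℕ // p.Prime} → Type) [∀ p, CommRing (R p)]

/-- The ideal `⨁ R_p` of `∏ R_p`: the families with only finitely many nonzero components. -/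
def finiteSupport : Ideal (∀ p, R p) where
  carrier := {f | {p | f p ≠ 0}.Finite}
  add_mem' := by
    intro f g hf hg
    refine (Set.Finite.union hf hg).subset fun p hp => ?_
    by_contra h
    simp only [Set.mem_union, Set.mem_ofPred_eq, not_or, not_not] at h
    exact hp (by simp [h.1, h.2])
  zero_mem' := by simp
  smul_mem' := by
    intro c f hf
    refine Set.Finite.subset hf fun p hp h => hp ?_
    simp [h]

/-- The quotient `∏ R_p / ⨁ R_p`: families modulo equality at all but finitely many primes. -/
abbrev AlmostAll : Type := (∀ p, R p) ⧸ finiteSupport R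

variable [∀ p : {p : ℕ // p.Prime}, Algebra (ZMod p) (R p)]

theorem isUnit_intCast (n : nonZeroDivisors ℤ) : IsUnit (Int.castRingHom (AlmostAll R) n) := by
  obtain ⟨n, hn⟩ := n
  have hn0 : n ≠ 0 := nonZeroDivisors.ne_zero hn
  refine IsUnit.of_mul_eq_one
    (Ideal.Quotient.mk (finiteSupport R) fun p => algebraMap (ZMod p) (R p) ((n : ZMod p)⁻¹)) ?_
  have h1 : Int.castRingHom (AlmostAll R) n = Ideal.Quotient.mk (finiteSupport R) (n : ∀ p, R p) := by
    simp
  simp only [h1]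
  rw [← map_mul, ← map_one (Ideal.Quotient.mk (finiteSupport R)), Ideal.Quotient.eq]
  refine Set.Finite.subset (s := {p : {p : ℕ // p.Prime} | (p : ℕ) ∈ Finset.range (n.natAbs + 1)})
    (Set.Finite.preimage (fun _ _ _ _ h => Subtype.ext h) (Finset.finite_toSet _)) fun p hp => ?_
  by_contra h
  apply hp
  have hlt : n.natAbs < p := by
    simp only [Set.mem_ofPred_eq, Finset.mem_range, not_lt] at h
    omega
  have : Fact (p : ℕ).Prime := ⟨p.2⟩
  have hne : (n : ZMod p) ≠ 0 := by
    rw [Ne, ZMod.intCast_zmod_eq_zero_iff_dvd]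
    intro hd
    have := Int.natAbs_dvd_natAbs.mpr hd
    rw [Int.natAbs_natCast] at this
    exact absurd (Nat.le_of_dvd (Int.natAbs_pos.mpr hn0) this) (by omega)
  have : (n : R p) = algebraMap (ZMod p) (R p) (n : ZMod p) := by simp
  simp only [Pi.sub_apply, Pi.mul_apply, Pi.one_apply, Pi.intCast_apply, this, ← map_mul,
    mul_inv_cancel₀ hne, map_one, sub_self]

/-- The `ℚ`-algebra structure, which exists since each nonzero integer is invertible at all but
finitely many primes. -/
noncomputable instance : Algebra ℚ (AlmostAll R) :=
  (IsLocalization.lift (M := nonZeroDivisors ℤ) (isUnit_intCast R)).toAlgebra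

end AlmostAll

open scoped Polynomial

/-- The ring `𝒜 = ∏ 𝔽_p / ⨁ 𝔽_p`. -/
abbrev A : Type := AlmostAll fun p => ZMod p

/-- The ring `ℬ = ∏ 𝔽_p[T] / ⨁ 𝔽_p[T]`. -/
abbrev B : Type := AlmostAll fun p => (ZMod p)[X]

/-- The inclusion of `𝒜` into `ℬ` as constant polynomials. -/
noncomputable def constB : A →+* B :=
  Ideal.quotientMap (finiteSupport fun p => (ZMod p)[X])
    (RingHom.pi fun p => Polynomial.C.comp (Pi.evalRingHom (fun p : {p : ℕ // p.Prime} => ZMod p) p))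
    (fun f hf => Set.Finite.subset hf fun p hp h => hp (by
      change Polynomial.C (f p) = 0
      rw [h, map_zero]))

/-! ### Finite multiple zeta values and finite multiple polylogarithms -/

/-- The partial sum `l_1 + ⋯ + l_i`. -/
def partialSum {r : ℕ} (l : Fin r → ℕ) (i : Fin r) : ℕ := ∑ j ∈ Finset.Iic i, l j

/-- The product `l_1 ^ k_1 (l_1 + l_2) ^ k_2 ⋯ (l_1 + ⋯ + l_r) ^ k_r`. -/
def denom (k : Index) (l : Fin k.length → ℕ) : ℕ := ∏ i, partialSum l i ^ (k.get i : ℕ)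

/-- The tuples `(l_1, …, l_r)` of integers with `0 < l_1, …, l_r < p`. -/
def box (r p : ℕ) : Finset (Fin r → ℕ) := Fintype.piFinset fun _ => Finset.Ioo 0 p

/-- The finite multiple zeta value `ζ_𝒜(k)`; its component at `p` is the sum of the inverses of
`l_1 ^ k_1 ⋯ (l_1 + ⋯ + l_r) ^ k_r` over all positive `l_1, …, l_r` with `l_1 + ⋯ + l_r < p`. For the
empty index it is `1`. -/
noncomputable def zetaA (k : Index) : A :=
  Ideal.Quotient.mk (finiteSupport fun p => ZMod p) fun p =>
    ∑ l ∈ box k.length p with ∑ i, l i < (p : ℕ), (denom k l : ZMod p)⁻¹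

/-- The finite multiple polylogarithm `li_k(T)`; its component at `p` is the sum of the fractions
`T ^ (l_1 + ⋯ + l_r) / (l_1 ^ k_1 ⋯ (l_1 + ⋯ + l_r) ^ k_r)` over all `0 < l_1, …, l_r < p` for which
the denominator is prime to `p`. For the empty index it is `1`. -/
noncomputable def li (k : Index) : B :=
  Ideal.Quotient.mk (finiteSupport fun p => (ZMod p)[X]) fun p =>
    ∑ l ∈ box k.length p with (denom k l).Coprime p,
      Polynomial.C (denom k l : ZMod p)⁻¹ * Polynomial.X ^ ∑ i, l i

/-- The element `T ^ p` of `ℬ`. -/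
noncomputable def Tp : B :=
  Ideal.Quotient.mk (finiteSupport fun p => (ZMod p)[X]) fun p => Polynomial.X ^ (p : ℕ)

/-! ### The filtration and its associated graded algebra -/

/-- The space `ℛ_{a,b}`, spanned by the `ζ_𝒜(k) (T ^ p) ^ n li_{k'}(T)` with `n ≥ 0`,
`wt k + wt k' = a` and `wt k' ≤ b`. -/
noncomputable def Rab (a b : ℕ) : Submodule ℚ B :=
  Submodule.span ℚ {f | ∃ (k k' : Index) (n : ℕ), wt k + wt k' = a ∧ wt k' ≤ b ∧
    f = constB (zetaA k) * Tp ^ n * li k'}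

/-- The space `ℛ_{a,b-1}`, which is `0` for `b = 0`. -/
noncomputable def RabPred (a : ℕ) : ℕ → Submodule ℚ B
  | 0 => ⊥
  | b + 1 => Rab a b

/-- The bidegrees `(a, b)` with `a ≥ b ≥ 0`, a submonoid of `ℕ × ℕ`. -/
def bidegrees : AddSubmonoid (ℕ × ℕ) where
  carrier := {i | i.2 ≤ i.1}
  add_mem' := fun h h' => Nat.add_le_add h h'
  zero_mem' := Nat.le_refl 0

/-- The type of bidegrees `(a, b)` with `a ≥ b ≥ 0`. -/
abbrev Bideg : Type := bidegrees

/-- The space `ℛ_{a,b} / ℛ_{a,b-1}`. -/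
def Piece (i : Bideg) : Type :=
  Rab i.1.1 i.1.2 ⧸ (RabPred i.1.1 i.1.2).submoduleOf (Rab i.1.1 i.1.2)

noncomputable instance (i : Bideg) : AddCommGroup (Piece i) :=
  inferInstanceAs (AddCommGroup
    (Rab i.1.1 i.1.2 ⧸ (RabPred i.1.1 i.1.2).submoduleOf (Rab i.1.1 i.1.2)))

noncomputable instance (i : Bideg) : Module ℚ (Piece i) :=
  inferInstanceAs (Module ℚ
    (Rab i.1.1 i.1.2 ⧸ (RabPred i.1.1 i.1.2).submoduleOf (Rab i.1.1 i.1.2)))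

/-- The class in `ℛ_{a,b} / ℛ_{a,b-1}` of an element of `ℛ_{a,b}`. -/
noncomputable def cls (i : Bideg) (f : B) (hf : f ∈ Rab i.1.1 i.1.2) : Piece i :=
  Submodule.Quotient.mk ⟨f, hf⟩

/-- The filtration is multiplicative: `ℛ_{a₁,b₁} ⬝ ℛ_{a₂,b₂} ⊆ ℛ_{a₁+a₂,b₁+b₂}` for all
`a₁ ≥ b₁ ≥ 0` and `a₂ ≥ b₂ ≥ 0`. -/
def FiltrationMul : Prop :=
  ∀ a₁ b₁ a₂ b₂ : ℕ, b₁ ≤ a₁ → b₂ ≤ a₂ → ∀ f ∈ Rab a₁ b₁, ∀ g ∈ Rab a₂ b₂,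
    f * g ∈ Rab (a₁ + a₂) (b₁ + b₂)

theorem zetaA_nil : zetaA [] = 1 := by
  rw [zetaA, ← map_one (Ideal.Quotient.mk (finiteSupport fun p => ZMod p))]
  congr 1
  funext p
  have : 0 < (p : ℕ) := p.2.pos
  simp [box, denom, Finset.filter_true_of_mem, this]

theorem li_nil : li [] = 1 := by
  rw [li, ← map_one (Ideal.Quotient.mk (finiteSupport fun p => (ZMod p)[X]))]
  congr 1
  funext p
  simp [box, denom, Finset.filter_true_of_mem]

theorem one_mem_Rab : (1 : B) ∈ Rab 0 0 :=
  Submodule.subset_span ⟨[], [], 0, by simp [wt], by simp [wt], by simp [zetaA_nil, li_nil]⟩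

theorem RabPred_mul (h : FiltrationMul) (i j : Bideg) (f g : B) (hf : f ∈ RabPred i.1.1 i.1.2)
    (hg : g ∈ Rab j.1.1 j.1.2) : f * g ∈ RabPred (i + j).1.1 (i + j).1.2 := by
  obtain ⟨⟨a, b⟩, hi⟩ := i
  obtain ⟨⟨c, d⟩, hj⟩ := j
  cases b with
  | zero =>
    have : f = 0 := by simpa [RabPred] using hf
    rw [this, zero_mul]
    exact Submodule.zero_mem _
  | succ b =>
    have := h a b c d (Nat.le_of_succ_le hi) hj f hf g hg
    change f * g ∈ RabPred (a + c) (b + 1 + d)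
    rwa [Nat.add_right_comm]

theorem cls_eq_iff (i : Bideg) (f g : B) (hf : f ∈ Rab i.1.1 i.1.2) (hg : g ∈ Rab i.1.1 i.1.2) :
    cls i f hf = cls i g hg ↔ f - g ∈ RabPred i.1.1 i.1.2 := by
  exact Submodule.Quotient.eq ((RabPred i.1.1 i.1.2).submoduleOf (Rab i.1.1 i.1.2))

theorem mul_mem_Rab (h : FiltrationMul) (i j : Bideg) {f g : B} (hf : f ∈ Rab i.1.1 i.1.2)
    (hg : g ∈ Rab j.1.1 j.1.2) : f * g ∈ Rab (i + j).1.1 (i + j).1.2 :=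
  h _ _ _ _ i.2 j.2 f hf g hg

/-- The product of graded pieces induced by the product of `ℬ`: `[f] [g] = [f g]`. -/
noncomputable def pieceMul (h : FiltrationMul) {i j : Bideg} (x : Piece i) (y : Piece j) :
    Piece (i + j) :=
  Quotient.liftOn₂' (s₁ := Submodule.quotientRel _) (s₂ := Submodule.quotientRel _) x y (fun f g => cls (i + j) (f.1 * g.1) (mul_mem_Rab h i j f.2 g.2)) (by
    intro f g f' g' hf hg
    have hf : f.1 - f'.1 ∈ RabPred i.1.1 i.1.2 :=
      (cls_eq_iff i f.1 f'.1 f.2 f'.2).mp (Quotient.sound hf)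
    have hg : g.1 - g'.1 ∈ RabPred j.1.1 j.1.2 :=
      (cls_eq_iff j g.1 g'.1 g.2 g'.2).mp (Quotient.sound hg)
    rw [cls_eq_iff]
    have e : f.1 * g.1 - f'.1 * g'.1 = (f.1 - f'.1) * g.1 + (g.1 - g'.1) * f'.1 := by ring
    rw [e]
    have h1 := RabPred_mul h i j _ _ hf g.2
    have h2 := RabPred_mul h j i _ _ hg f'.2
    rw [add_comm j i] at h2
    exact Submodule.add_mem _ h1 h2)

theorem pieceMul_cls (h : FiltrationMul) (i j : Bideg) (f g : B) (hf : f ∈ Rab i.1.1 i.1.2)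
    (hg : g ∈ Rab j.1.1 j.1.2) :
    pieceMul h (cls i f hf) (cls j g hg) = cls (i + j) (f * g) (mul_mem_Rab h i j hf hg) := rfl

theorem exists_cls {i : Bideg} (x : Piece i) : ∃ f hf, x = cls i f hf := by
  obtain ⟨f, rfl⟩ := Submodule.Quotient.mk_surjective _ x
  exact ⟨f.1, f.2, rfl⟩

theorem cls_add (i : Bideg) (f g : B) (hf : f ∈ Rab i.1.1 i.1.2) (hg : g ∈ Rab i.1.1 i.1.2) :
    cls i f hf + cls i g hg = cls i (f + g) (Submodule.add_mem _ hf hg) := rfl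

theorem cls_smul (i : Bideg) (r : ℚ) (f : B) (hf : f ∈ Rab i.1.1 i.1.2) :
    r • cls i f hf = cls i (r • f) (Submodule.smul_mem _ r hf) := rfl

theorem cls_zero (i : Bideg) : (0 : Piece i) = cls i 0 (Submodule.zero_mem _) := rfl

theorem mk_cls_eq {i j : Bideg} (hij : i = j) {f g : B} (hfg : f = g)
    (hf : f ∈ Rab i.1.1 i.1.2) (hg : g ∈ Rab j.1.1 j.1.2) :
    (GradedMonoid.mk i (cls i f hf) : GradedMonoid Piece) = GradedMonoid.mk j (cls j g hg) := by
  subst hij hfg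
  rfl

/-- The multiplication on the graded pieces induced by the product of `ℬ`. -/
@[reducible] noncomputable def pieceGMul (h : FiltrationMul) : GradedMonoid.GMul Piece where
  mul := pieceMul h

/-- The class of `1` in bidegree `(0, 0)`. -/
@[reducible] noncomputable def pieceGOne : GradedMonoid.GOne Piece where
  one := cls 0 1 one_mem_Rab

/-- The graded monoid structure induced by the product of `ℬ`. -/
@[reducible] noncomputable def pieceMonoid (h : FiltrationMul) : GradedMonoid.GCommMonoid Piece :=
  letI := pieceGMul h
  letI := pieceGOne
  { mul := pieceMul h
    one := cls 0 1 one_mem_Rab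
    one_mul := by
      rintro ⟨i, x⟩
      obtain ⟨f, hf, rfl⟩ := exists_cls x
      exact mk_cls_eq (zero_add i) (one_mul f) _ _
    mul_one := by
      rintro ⟨i, x⟩
      obtain ⟨f, hf, rfl⟩ := exists_cls x
      exact mk_cls_eq (add_zero i) (mul_one f) _ _
    mul_assoc := by
      rintro ⟨i, x⟩ ⟨j, y⟩ ⟨k, w⟩
      obtain ⟨f, hf, rfl⟩ := exists_cls x
      obtain ⟨g, hg, rfl⟩ := exists_cls y
      obtain ⟨e, he, rfl⟩ := exists_cls w
      exact mk_cls_eq (add_assoc i j k) (mul_assoc f g e) _ _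
    mul_comm := by
      rintro ⟨i, x⟩ ⟨j, y⟩
      obtain ⟨f, hf, rfl⟩ := exists_cls x
      obtain ⟨g, hg, rfl⟩ := exists_cls y
      exact mk_cls_eq (add_comm i j) (mul_comm f g) _ _ }

/-- The graded ring structure induced by the product of `ℬ`. -/
@[reducible] noncomputable def pieceRing (h : FiltrationMul) : DirectSum.GCommRing Piece where
  toGMonoid := (pieceMonoid h).toGMonoid
  mul_comm := (pieceMonoid h).mul_comm
  mul_zero := by
    intro i j x
    obtain ⟨f, hf, rfl⟩ := exists_cls x
    change pieceMul h _ _ = _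
    simp only [cls_zero, pieceMul_cls, mul_zero]
  zero_mul := by
    intro i j x
    obtain ⟨f, hf, rfl⟩ := exists_cls x
    change pieceMul h _ _ = _
    simp only [cls_zero, pieceMul_cls, zero_mul]
  mul_add := by
    intro i j x y w
    obtain ⟨f, hf, rfl⟩ := exists_cls x
    obtain ⟨g, hg, rfl⟩ := exists_cls y
    obtain ⟨k, hk, rfl⟩ := exists_cls w
    change pieceMul h _ _ = pieceMul h _ _ + pieceMul h _ _
    simp only [cls_add, pieceMul_cls, mul_add]
  add_mul := by
    intro i j x y w
    obtain ⟨f, hf, rfl⟩ := exists_cls x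
    obtain ⟨g, hg, rfl⟩ := exists_cls y
    obtain ⟨k, hk, rfl⟩ := exists_cls w
    change pieceMul h _ _ = pieceMul h _ _ + pieceMul h _ _
    simp only [cls_add, pieceMul_cls, add_mul]
  natCast n := n • cls 0 1 one_mem_Rab
  natCast_zero := zero_nsmul _
  natCast_succ n := succ_nsmul _ n
  intCast n := n • cls 0 1 one_mem_Rab
  intCast_ofNat n := natCast_zsmul _ n
  intCast_negSucc_ofNat n := negSucc_zsmul _ n

/-- The `ℚ`-algebra structure on the graded ring. -/
@[reducible] noncomputable def pieceAlgebra (h : FiltrationMul) :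
    letI := pieceRing h
    DirectSum.GAlgebra ℚ Piece :=
  letI := pieceRing h
  { toFun := (LinearMap.toSpanSingleton ℚ (Piece 0) (cls 0 1 one_mem_Rab)).toAddMonoidHom
    map_one := one_smul ℚ (cls 0 1 one_mem_Rab)
    map_mul := fun r s => mk_cls_eq (zero_add 0).symm (by
      change (r * s) • (1 : B) = (r • (1 : B)) * (s • (1 : B))
      rw [smul_mul_smul_comm, mul_one]) _ _
    commutes := by
      rintro r ⟨i, x⟩
      obtain ⟨f, hf, rfl⟩ := exists_cls x
      exact mk_cls_eq (add_comm 0 i) (mul_comm _ _) _ _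
    smul_def := by
      rintro r ⟨i, x⟩
      obtain ⟨f, hf, rfl⟩ := exists_cls x
      exact mk_cls_eq (zero_add i).symm (by simp) _ _ }

open scoped DirectSum

/-- The `ℚ`-algebra `⨁_{a ≥ b ≥ 0} ℛ_{a,b} / ℛ_{a,b-1}`, whose product is the one induced by the
product of `ℬ` on account of the multiplicativity `h` of the filtration. -/
def Rbar (_ : FiltrationMul) : Type := ⨁ i, Piece i

noncomputable instance (h : FiltrationMul) : CommRing (Rbar h) :=
  letI := pieceRing h
  inferInstanceAs (CommRing (⨁ i, Piece i))

noncomputable instance (h : FiltrationMul) : Algebra ℚ (Rbar h) :=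
  letI := pieceRing h
  letI := pieceAlgebra h
  inferInstanceAs (Algebra ℚ (⨁ i, Piece i))

/-- The class in `ℛ_{a,b} / ℛ_{a,b-1}`, as an element of the graded algebra. -/
noncomputable def Rbar.of (h : FiltrationMul) (i : Bideg) : Piece i →ₗ[ℚ] Rbar h :=
  DirectSum.lof ℚ Bideg Piece i

/-- The bidegree `(wt k + wt k', wt k')`. -/
def bideg (k k' : Index) : Bideg :=
  ⟨(wt k + wt k', wt k'), show wt k' ≤ wt k + wt k' from Nat.le_add_left _ _⟩

theorem zeta_mul_li_mem (k k' : Index) :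
    constB (zetaA k) * li k' ∈ Rab (bideg k k').1.1 (bideg k k').1.2 :=
  Submodule.subset_span ⟨k, k', 0, rfl, le_rfl, by simp⟩

/-- The `ℚ`-linear map sending `u_k v_{k'}` to the class of `ζ_𝒜(k) li_{k'}(T)` in
`ℛ_{a,b} / ℛ_{a,b-1}`, where `a = wt k + wt k'` and `b = wt k'`. -/
noncomputable def phi (h : FiltrationMul) : StuffleShuffle →ₗ[ℚ] Rbar h :=
  uv.constr ℚ fun k =>
    Rbar.of h (bideg k.1 k.2) (cls _ (constB (zetaA k.1) * li k.2) (zeta_mul_li_mem k.1 k.2))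

end FMP

/-! The zeta factors multiply exactly by the stuffle rule, while polylogarithms obey the shuffle
rule only up to terms of lower filtration degree; the work lies in bounding the error.

Over `𝔽_p`, let `integ` be the inverse of `T d/dT` that kills exponents divisible by `p`. A finite
polylogarithm is then an iterated integral read off its word: `x` integrates, and `y` multiplies by
`geom = T + ⋯ + T ^ (p - 1)` and integrates. `T d/dT` is a derivation, but `integ` inverts it only
up to `projTp`, the projection onto polynomials in `T ^ p`. Integration by parts (`integ_mul_integ`)
therefore yields the shuffle recursion plus three corrections, each containing a projection.

Every projection that occurs is a combination of `ζ_𝒜(k) (T ^ p) ^ n`, so it lies in some `ℛ_{c,0}`: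
its weight has moved from the polylogarithm to the zeta factor, and the second degree drops. This is
proved in two steps. A polylogarithm of a nonempty word expands in truncated ones (degrees below
`p`) with coefficients of that kind, by `integ_geom_mul_truncLi` and `liB_mem_truncSpan`. A product
of two truncated ones has degree below `2p` and no constant term, so only its coefficient of `T ^ p`
survives projection. Since `1/m = -1/n` in `𝔽_p` when `m + n = p`, integrations can be moved from
one factor to the other (`coeff_mul_integ`) until a truncated polylogarithm at `1` remains, which is
a zeta value (`exists_coeff_truncLi_mul`). The resulting word and sign do not depend on `p`, so the
identity passes to `ℬ`.

Induction on words gives `liB_mul_liB`, the shuffle relation modulo `ℛ_{a,a-1}`. The stuffle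
relation `zetaA_mul` comes from rewriting zeta values as sums over `n_1 < ⋯ < n_r < p`. Both
products are homogeneous in the weight, so the two relations give the multiplicativity of the
filtration and of `phi`. -/

namespace FMP

open scoped Polynomial TensorProduct DirectSum
open Polynomial

/-! ### Operators on polynomials over `𝔽_p` -/

section Scale

variable {R : Type*} [CommRing R]

/-- Multiplication of the coefficient of `X ^ n` by `c n`. -/
noncomputable def scale (c : ℕ → R) : R[X] →ₗ[R] R[X] :=
  Polynomial.lsum fun n => c n • Polynomial.monomial n

@[simp] theorem scale_monomial (c : ℕ → R) (n : ℕ) (a : R) :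
    scale c (monomial n a) = monomial n (c n * a) := by
  rw [scale, Polynomial.lsum_apply, Polynomial.sum_monomial_index _ _ (by simp),
    LinearMap.smul_apply, smul_monomial, smul_eq_mul]

@[simp] theorem coeff_scale (c : ℕ → R) (f : R[X]) (n : ℕ) :
    (scale c f).coeff n = c n * f.coeff n := by
  induction f using Polynomial.induction_on' with
  | add f g hf hg => simp [hf, hg, mul_add]
  | monomial m a =>
    rw [scale_monomial, coeff_monomial, coeff_monomial]
    split_ifs with h
    · rw [h]
    · simp

/-- The exponents that survive in `scale c f` are periods of `d`, so multiplying by them leaves the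
scaling factors of `g` unchanged. With `c` the indicator of the multiples of `p`, this makes `integ`
and `projTp` linear over polynomials in `T ^ p`. -/
theorem scale_mul_of_periodic {c d : ℕ → R} (h : ∀ n m, c n ≠ 0 → d (n + m) = d m) (f g : R[X]) :
    scale d (scale c f * g) = scale c f * scale d g := by
  induction f using Polynomial.induction_on' with
  | add f f' hf hf' => simp only [map_add, add_mul, hf, hf']
  | monomial n a =>
    induction g using Polynomial.induction_on' with
    | add g g' hg hg' => simp only [map_add, mul_add, hg, hg']
    | monomial m b =>
      by_cases hn : c n = 0
      · simp [hn]
      · simp only [scale_monomial, monomial_mul_monomial, h n m hn]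
        congr 1
        ring

/-- Scaling by the exponent is the Euler operator `X d/dX`, hence a derivation. -/
theorem scale_cast_mul (f g : R[X]) :
    scale (fun n => (n : R)) (f * g) =
      scale (fun n => (n : R)) f * g + f * scale (fun n => (n : R)) g := by
  have key : ∀ f : R[X], scale (fun n => (n : R)) f = X * derivative f := by
    intro f
    ext n
    cases n with
    | zero => simp
    | succ n => rw [coeff_scale, coeff_X_mul, coeff_derivative]; push_cast; ring
  simp only [key, derivative_mul]
  ring

end Scale

/-! ### Integration, projection and truncation over `𝔽_p` -/

section Components

variable (p : ℕ)

/-- The inverse of the derivation `T d/dT`: the term `T ^ n` is divided by `n` if `n` is prime to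
`p`, and removed otherwise. -/
noncomputable def integ : (ZMod p)[X] →ₗ[ZMod p] (ZMod p)[X] := scale fun n => (n : ZMod p)⁻¹

/-- The projection onto polynomials in `T ^ p`. -/
noncomputable def projTp : (ZMod p)[X] →ₗ[ZMod p] (ZMod p)[X] :=
  scale fun n => if (n : ZMod p) = 0 then 1 else 0

/-- Truncation to degrees less than `p`. -/
noncomputable def trunc : (ZMod p)[X] →ₗ[ZMod p] (ZMod p)[X] :=
  scale fun n => if n < p then 1 else 0

/-- The polynomial `T + ⋯ + T ^ (p - 1)`. -/
noncomputable def geom : (ZMod p)[X] := ∑ l ∈ Finset.Ioo 0 p, X ^ l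

/-- The factor attached to a letter. -/
noncomputable def letterFactor : Letter → (ZMod p)[X]
  | Letter.x => 1
  | Letter.y => geom p

/-- The finite multiple polylogarithm attached to a word. -/
noncomputable def liWord : List Letter → (ZMod p)[X]
  | [] => 1
  | a :: w => integ p (letterFactor p a * liWord w)

/-- The truncated finite multiple polylogarithm attached to a word. -/
noncomputable def truncLi (w : List Letter) : (ZMod p)[X] := trunc p (liWord p w)

@[simp] theorem coeff_integ (f : (ZMod p)[X]) (n : ℕ) :
    (integ p f).coeff n = (n : ZMod p)⁻¹ * f.coeff n := coeff_scale _ _ _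

theorem coeff_zero_integ (f : (ZMod p)[X]) : (integ p f).coeff 0 = 0 := by
  rw [coeff_integ, Nat.cast_zero, ZMod.inv_zero, zero_mul]

theorem coeff_trunc (f : (ZMod p)[X]) (n : ℕ) :
    (trunc p f).coeff n = if n < p then f.coeff n else 0 := by
  rw [trunc, coeff_scale]; split_ifs <;> simp

theorem coeff_projTp (f : (ZMod p)[X]) (n : ℕ) :
    (projTp p f).coeff n = if (n : ZMod p) = 0 then f.coeff n else 0 := by
  rw [projTp, coeff_scale]; split_ifs <;> simp

theorem coeff_geom (n : ℕ) : (geom p).coeff n = if 0 < n ∧ n < p then 1 else 0 := by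
  simp [geom, coeff_X_pow, Finset.sum_ite_eq]

theorem trunc_integ (f : (ZMod p)[X]) : trunc p (integ p f) = integ p (trunc p f) := by
  ext n
  simp only [coeff_trunc, coeff_integ, mul_ite, mul_zero]

theorem trunc_mul_trunc (f g : (ZMod p)[X]) : trunc p (f * trunc p g) = trunc p (f * g) := by
  ext n
  simp only [coeff_trunc]
  split_ifs with h
  · rw [coeff_mul, coeff_mul]
    refine Finset.sum_congr rfl fun x hx => ?_
    rw [coeff_trunc, if_pos]
    have := Finset.HasAntidiagonal.mem_antidiagonal.mp hx
    omega
  · rfl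

theorem truncLi_cons (a : Letter) (w : List Letter) :
    truncLi p (a :: w) = integ p (trunc p (letterFactor p a * truncLi p w)) := by
  rw [truncLi, truncLi, liWord, trunc_integ, trunc_mul_trunc]

theorem trunc_truncLi (w : List Letter) : trunc p (truncLi p w) = truncLi p w := by
  ext n
  simp only [truncLi, coeff_trunc]
  split_ifs <;> rfl

theorem truncLi_cons_x (w : List Letter) :
    truncLi p (Letter.x :: w) = integ p (truncLi p w) := by
  rw [truncLi_cons, letterFactor, one_mul, trunc_truncLi]

theorem truncLi_cons_y (w : List Letter) :
    truncLi p (Letter.y :: w) = integ p (trunc p (geom p * truncLi p w)) :=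
  truncLi_cons p _ w

theorem coeff_zero_truncLi {w : List Letter} (hw : w ≠ []) : (truncLi p w).coeff 0 = 0 := by
  cases w with
  | nil => exact absurd rfl hw
  | cons a w => rw [truncLi_cons, coeff_zero_integ]

theorem coeff_truncLi_of_le (w : List Letter) {n : ℕ} (hn : p ≤ n) :
    (truncLi p w).coeff n = 0 := by
  rw [truncLi, coeff_trunc, if_neg (by omega)]

theorem integ_C_mul (a : ZMod p) (f : (ZMod p)[X]) : integ p (C a * f) = C a * integ p f := by
  rw [← smul_eq_C_mul, map_smul, smul_eq_C_mul]

theorem projTp_C_mul (a : ZMod p) (f : (ZMod p)[X]) : projTp p (C a * f) = C a * projTp p f := by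
  rw [← smul_eq_C_mul, map_smul, smul_eq_C_mul]

theorem projTp_X_pow : projTp p (X ^ p) = X ^ p := by
  ext n
  rw [coeff_projTp, coeff_X_pow]
  split_ifs with h1 h2 <;> simp_all

theorem integ_projTp_mul (f g : (ZMod p)[X]) :
    integ p (projTp p f * g) = projTp p f * integ p g :=
  scale_mul_of_periodic (fun n m h => by
    have : (n : ZMod p) = 0 := by by_contra h'; simp [h'] at h
    simp [this]) f g

theorem projTp_projTp_mul (f g : (ZMod p)[X]) :
    projTp p (projTp p f * g) = projTp p f * projTp p g :=
  scale_mul_of_periodic (fun n m h => by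
    have : (n : ZMod p) = 0 := by by_contra h'; simp [h'] at h
    simp [this]) f g

theorem integ_Xp_mul (f : (ZMod p)[X]) : integ p (X ^ p * f) = X ^ p * integ p f := by
  have := integ_projTp_mul p (X ^ p) f
  rwa [projTp_X_pow] at this

theorem projTp_Xp_mul (f : (ZMod p)[X]) : projTp p (X ^ p * f) = X ^ p * projTp p f := by
  have := projTp_projTp_mul p (X ^ p) f
  rwa [projTp_X_pow] at this

theorem integ_one : integ p 1 = 0 := by
  ext n
  rw [coeff_integ, coeff_one]
  split_ifs with h
  · rw [h, Nat.cast_zero, ZMod.inv_zero, zero_mul, coeff_zero]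
  · simp

theorem projTp_geom : projTp p (geom p) = 0 := by
  ext n
  rw [coeff_projTp, coeff_geom]
  split_ifs with h1 h2
  · rw [ZMod.natCast_eq_zero_iff] at h1
    exact absurd (Nat.le_of_dvd h2.1 h1) (by omega)
  all_goals simp

theorem projTp_integ (f : (ZMod p)[X]) : projTp p (integ p f) = 0 := by
  ext n
  rw [coeff_projTp, coeff_integ]
  split_ifs with h1
  · rw [h1, ZMod.inv_zero, zero_mul, coeff_zero]
  · rfl

/-- As `f` has no constant term, the coefficient of `X ^ p` sees `g` only in degrees below `p`. -/
theorem coeff_mul_trunc (f g : (ZMod p)[X]) (hf : f.coeff 0 = 0) :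
    (f * trunc p g).coeff p = (f * g).coeff p := by
  rw [coeff_mul, coeff_mul]
  refine Finset.sum_congr rfl fun x hx => ?_
  have h := Finset.HasAntidiagonal.mem_antidiagonal.mp hx
  rw [coeff_trunc]
  split_ifs with h1
  · rfl
  · have : x.1 = 0 := by omega
    rw [this, hf, zero_mul, zero_mul]

/-- Neither truncation affects the coefficient of `X ^ p`, so the factor `geom` can move from one
side to the other. This is how a letter `y` changes factors in `exists_coeff_truncLi_mul`. -/
theorem coeff_trunc_geom_mul_mul (f g : (ZMod p)[X]) (hf : f.coeff 0 = 0) (hg : g.coeff 0 = 0) :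
    (f * trunc p (geom p * g)).coeff p = (trunc p (geom p * f) * g).coeff p := by
  rw [coeff_mul_trunc p _ _ hf, mul_comm (trunc p _) g, coeff_mul_trunc p _ _ hg]
  congr 1
  ring

theorem truncLi_y : truncLi p [Letter.y] = liWord p [Letter.y] := by
  ext n
  rw [truncLi, coeff_trunc]
  split_ifs with h
  · rfl
  · rw [liWord, liWord, letterFactor, mul_one, coeff_integ, coeff_geom, if_neg (by omega), mul_zero]

/-! ### Integration by parts and coefficients at prime `p` -/

variable [Fact p.Prime]

/-- Integration by parts for `D = T d/dT`. Both `D ∘ integ` and `integ ∘ D` equal `1 - projTp`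
rather than the identity, and this defect produces the last three terms. -/
theorem integ_mul_integ (f g : (ZMod p)[X]) :
    integ p f * integ p g = integ p (f * integ p g) + integ p (integ p f * g) -
      projTp p f * integ p (integ p g) - projTp p g * integ p (integ p f) +
      projTp p (integ p f * integ p g) := by
  set D : (ZMod p)[X] →ₗ[ZMod p] (ZMod p)[X] := scale fun n => (n : ZMod p) with hD
  have h1 : ∀ f, D (integ p f) = f - projTp p f := by
    intro f
    ext n
    rw [hD, coeff_scale, coeff_sub, coeff_integ, coeff_projTp]
    split_ifs with h
    · simp [h]
    · rw [mul_inv_cancel_left₀ h, sub_zero]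
  have h2 : ∀ f, integ p (D f) = f - projTp p f := by
    intro f
    ext n
    rw [hD, coeff_integ, coeff_scale, coeff_sub, coeff_projTp]
    split_ifs with h
    · simp [h]
    · rw [inv_mul_cancel_left₀ h, sub_zero]
  -- Integrate the Leibniz rule for the product of the two integrals; the factors `projTp f` and
  -- `projTp g` come out of `integ` because they are polynomials in `X ^ p`.
  have h3 := h2 (integ p f * integ p g)
  rw [hD, scale_cast_mul, ← hD, h1, h1, mul_comm (integ p f) (g - _), sub_mul, sub_mul, map_add,
    map_sub, map_sub, integ_projTp_mul, integ_projTp_mul, mul_comm g] at h3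
  linear_combination -h3

/-- Exponents `m + n = p` satisfy `n = -m` in `𝔽_p`, so `1/n = -1/m`: at `X ^ p` an integration
changes sides at the cost of a sign. -/
theorem coeff_mul_integ (f g : (ZMod p)[X]) :
    (f * integ p g).coeff p = -(integ p f * g).coeff p := by
  rw [coeff_mul, coeff_mul, ← Finset.sum_neg_distrib]
  refine Finset.sum_congr rfl fun x hx => ?_
  have h : ((x.1 : ZMod p) + x.2) = 0 := by
    rw [← Nat.cast_add, Finset.HasAntidiagonal.mem_antidiagonal.mp hx, ZMod.natCast_self]
  rw [coeff_integ, coeff_integ, eq_neg_of_add_eq_zero_left h, inv_neg]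
  ring

theorem eval_one_trunc (f : (ZMod p)[X]) :
    (trunc p f).eval 1 = ∑ n ∈ Finset.range p, f.coeff n := by
  have hd : (trunc p f).natDegree < p := by
    by_contra! h
    have h0 : (trunc p f).coeff (trunc p f).natDegree = 0 := by
      rw [coeff_trunc, if_neg (by omega)]
    have h1 : trunc p f = 0 := leadingCoeff_eq_zero.mp h0
    rw [h1, natDegree_zero] at h
    exact (Fact.out : p.Prime).pos.not_ge h
  rw [eval_eq_sum_range' hd]
  refine Finset.sum_congr rfl fun n hn => ?_
  rw [coeff_trunc, if_pos (Finset.mem_range.mp hn), one_pow, mul_one]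

/-- Against `geom`, the coefficient of `X ^ p` adds up the coefficients of `f` in degrees `1` to `p
- 1`. The value at `1` also counts degree `0`, hence the hypothesis `hf`. -/
theorem coeff_mul_geom (f : (ZMod p)[X]) (hf : f.coeff 0 = 0) :
    (f * geom p).coeff p = (trunc p f).eval 1 := by
  rw [eval_one_trunc, coeff_mul, Finset.Nat.sum_antidiagonal_eq_sum_range_succ_mk,
    Finset.sum_range_succ]
  rw [Nat.sub_self, coeff_geom, if_neg (by simp), mul_zero, add_zero]
  refine Finset.sum_congr rfl fun n hn => ?_
  have hn := Finset.mem_range.mp hn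
  rcases Nat.eq_zero_or_pos n with rfl | h
  · rw [hf, zero_mul]
  · rw [coeff_geom, if_pos (by omega), mul_one]

/-- The product has degree below `2p` and no constant term, so `p` is the only multiple of `p` among
its exponents. -/
theorem projTp_mul_of_small (f g : (ZMod p)[X]) (hf : ∀ n, p ≤ n → f.coeff n = 0)
    (hg : ∀ n, p ≤ n → g.coeff n = 0) (hf0 : f.coeff 0 = 0) :
    projTp p (f * g) = C ((f * g).coeff p) * X ^ p := by
  ext n
  rw [coeff_projTp, coeff_C_mul_X_pow]
  have hz : (f * g).coeff 0 = 0 := by rw [mul_coeff_zero, hf0, zero_mul]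
  by_cases hn : n = p
  · subst hn
    simp
  · rw [if_neg hn]
    split_ifs with h
    · obtain ⟨k, rfl⟩ := (ZMod.natCast_eq_zero_iff _ _).mp h
      match k with
      | 0 => simpa using hz
      | 1 => simp at hn
      | k + 2 =>
        rw [coeff_mul]
        refine Finset.sum_eq_zero fun x hx => ?_
        have h1 := Finset.HasAntidiagonal.mem_antidiagonal.mp hx
        have h2 : p * (k + 2) = p * k + 2 * p := by ring
        rcases le_or_gt p x.1 with h3 | h3
        · rw [hf _ h3, zero_mul]
        · rw [hg x.2 (by omega), mul_zero]
    · rfl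

/-- The exponents `m + 1, …, m + p - 1` split at `p`. Those below `p` form the truncation, `p`
itself gives the last term, and `p + 1, …, p + m - 1` are the exponents of `X ^ p * geom p` with `p
+ m` and the shifted truncation `p + m + 1, …, 2p - 1` taken away. -/
theorem geom_mul_X_pow {m : ℕ} (h0 : 0 < m) (hm : m < p) :
    geom p * X ^ m = (1 - X ^ p) * trunc p (geom p * X ^ m) + X ^ p * geom p - X ^ p * X ^ m +
      X ^ p := by
  have hc : ∀ n, (geom p * X ^ m).coeff n = if m < n ∧ n < p + m then 1 else 0 := by
    intro n
    rw [coeff_mul_X_pow', coeff_geom]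
    split_ifs <;> first | rfl | omega
  ext n
  rw [sub_mul, one_mul, coeff_add, coeff_sub, coeff_add, coeff_sub]
  simp only [coeff_X_pow_mul', coeff_trunc, hc, coeff_geom, coeff_X_pow]
  split_ifs <;> first | omega | simp

theorem geom_mul (f : (ZMod p)[X]) (hf : ∀ n, p ≤ n → f.coeff n = 0) (hf0 : f.coeff 0 = 0) :
    geom p * f = (1 - X ^ p) * trunc p (geom p * f) + X ^ p * (C (f.eval 1) * geom p) - X ^ p * f +
      X ^ p * C (f.eval 1) := by
  have hs : f = ∑ n ∈ Finset.Ioo 0 p, C (f.coeff n) * X ^ n := by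
    ext n
    simp only [finsetSum_coeff, coeff_C_mul_X_pow, Finset.sum_ite_eq, Finset.mem_Ioo]
    split_ifs with h
    · rfl
    · rcases Nat.eq_zero_or_pos n with rfl | h1
      · exact hf0
      · exact hf n (by omega)
  -- The coefficients are detached from `f` so that `hs` can rewrite `f` without reintroducing it.
  generalize f.coeff = c at hs
  have key : ∀ m ∈ Finset.Ioo 0 p, geom p * (C (c m) * X ^ m) =
      (1 - X ^ p) * trunc p (geom p * (C (c m) * X ^ m)) +
        X ^ p * (C ((C (c m) * X ^ m).eval 1) * geom p) - X ^ p * (C (c m) * X ^ m) +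
        X ^ p * C ((C (c m) * X ^ m).eval 1) := by
    intro m hm
    rw [Finset.mem_Ioo] at hm
    have e : geom p * (C (c m) * X ^ m) = c m • (geom p * X ^ m) := by
      rw [smul_eq_C_mul]; ring
    rw [e, map_smul, smul_eq_C_mul, smul_eq_C_mul]
    have := geom_mul_X_pow p hm.1 hm.2
    simp only [eval_mul, eval_C, eval_pow, eval_X, one_pow, mul_one]
    linear_combination C (c m) * this
  calc geom p * f = ∑ m ∈ Finset.Ioo 0 p, geom p * (C (c m) * X ^ m) := by rw [hs, Finset.mul_sum]
    _ = _ := Finset.sum_congr rfl key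
    _ = _ := ?_
  rw [hs, Finset.mul_sum (a := geom p), map_sum, eval_finsetSum, map_sum, Finset.mul_sum,
    Finset.sum_mul, Finset.mul_sum, Finset.mul_sum, Finset.mul_sum, ← Finset.sum_add_distrib,
    ← Finset.sum_sub_distrib, ← Finset.sum_add_distrib]

/-- Prepending `y` to a truncated polylogarithm gives truncated ones again, with coefficients that
are powers of `T ^ p` and one zeta value. The last term of `geom_mul` is a multiple of `X ^ p` and
is killed by `integ`. -/
theorem integ_geom_mul_truncLi {w : List Letter} (hw : w ≠ []) :
    integ p (geom p * truncLi p w) = truncLi p (Letter.y :: w) - X ^ p * truncLi p (Letter.y :: w) +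
      X ^ p * (C ((truncLi p w).eval 1) * truncLi p [Letter.y]) - X ^ p * truncLi p (Letter.x :: w) := by
  rw [geom_mul p _ (fun n => coeff_truncLi_of_le p w) (coeff_zero_truncLi p hw), truncLi_cons_y,
    truncLi_cons_x, truncLi_y, liWord, liWord, letterFactor, mul_one, sub_mul, one_mul, map_add, map_sub, map_add, map_sub]
  simp only [integ_Xp_mul, integ_C_mul]
  have h2 : integ p (C (eval 1 (truncLi p w))) = 0 := by
    rw [← mul_one (C _), integ_C_mul, integ_one, mul_zero]
  rw [h2, mul_zero, add_zero]

end Components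

/-! ### Words ending in `y`, and the coefficient of `T ^ p` in a product -/

theorem good_cons {a : Letter} {w : List Letter} (h : Good (a :: w)) :
    (w = [] ∧ a = Letter.y) ∨ (w ≠ [] ∧ Good w) := by
  rcases List.eq_nil_or_concat w with rfl | ⟨w', b, rfl⟩
  · left
    simpa [Good] using h
  · right
    simp only [Good, List.concat_eq_append, ← List.cons_append, List.getLast?_append] at h ⊢
    simpa using h

theorem Good.cons {w : List Letter} (a : Letter) (hw : w ≠ []) (h : Good w) : Good (a :: w) := by
  rcases List.eq_nil_or_concat w with rfl | ⟨w', b, rfl⟩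
  · exact absurd rfl hw
  · simp only [Good, List.concat_eq_append, ← List.cons_append, List.getLast?_append] at h ⊢
    simpa using h

theorem Good.cons_y {w : List Letter} (h : Good w) : Good (Letter.y :: w) := by
  by_cases hw : w = []
  · subst hw; right; rfl
  · exact h.cons _ hw

/-- The coefficient of `T ^ p` in a product of two truncated polylogarithms is, up to sign, a finite
multiple zeta value. -/
theorem exists_coeff_truncLi_mul (v : List Letter) (hv : v ≠ []) (hgv : Good v) :
    ∀ u : List Letter, u ≠ [] → Good u →
      (∃ w, Good w ∧ w.length = u.length + v.length ∧ ∀ p [Fact p.Prime],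
        (truncLi p u * truncLi p v).coeff p = (-1) ^ v.length * (truncLi p w).eval 1) ∧
      (∃ w, Good w ∧ w.length = u.length + v.length ∧ ∀ p [Fact p.Prime],
        (trunc p (geom p * truncLi p u) * truncLi p v).coeff p =
          (-1) ^ v.length * (truncLi p w).eval 1) := by
  induction v with
  | nil => exact absurd rfl hv
  | cons a v ih =>
    intro u hu hgu
    -- The induction strips letters off `v` and puts them on `u`. The second claim, with `trunc
    -- (geom * _)` in place of the truncated polylogarithm, is needed because a removed `y` leaves
    -- its factor `geom` behind, to be attached to the other side before any integration.
    rcases good_cons hgv with ⟨rfl, rfl⟩ | ⟨hv', hgv'⟩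
    · have h1 : ∀ p, truncLi p [Letter.y] = integ p (trunc p (geom p * 1)) := fun p => by
        rw [truncLi, liWord, trunc_integ, liWord, letterFactor]
      have h2 : ∀ p [Fact p.Prime] (f : (ZMod p)[X]),
          (f * truncLi p [Letter.y]).coeff p = -(trunc p (integ p f)).eval 1 := by
        intro p _ f
        have h0 : (integ p f).coeff 0 = 0 := coeff_zero_integ p f
        rw [h1, coeff_mul_integ, coeff_mul_trunc p _ _ h0, mul_one, coeff_mul_geom p _ h0]
      refine ⟨⟨Letter.x :: u, hgu.cons _ hu, by simp, fun p _ => ?_⟩,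
        ⟨Letter.y :: u, hgu.cons _ hu, by simp, fun p _ => ?_⟩⟩
      · rw [h2, ← truncLi_cons_x, trunc_truncLi]; simp
      · rw [h2, ← truncLi_cons_y, trunc_truncLi]; simp
    -- Moving the outer integration of `v` across turns `u` into `x u` in the first claim and into
    -- `y u` in the second, so the induction hypotheses are taken at both words.
    · obtain ⟨⟨wx, gx, lx, ex⟩, ⟨wx', gx', lx', ex'⟩⟩ :=
        ih hv' hgv' (Letter.x :: u) (List.cons_ne_nil _ _) (hgu.cons _ hu)
      obtain ⟨⟨wy, gy, ly, ey⟩, ⟨wy', gy', ly', ey'⟩⟩ :=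
        ih hv' hgv' (Letter.y :: u) (List.cons_ne_nil _ _) (hgu.cons _ hu)
      simp only [List.length_cons] at lx lx' ly ly' ⊢
      cases a with
      | x =>
        refine ⟨⟨wx, gx, by omega, fun p _ => ?_⟩, ⟨wy, gy, by omega, fun p _ => ?_⟩⟩
        · rw [truncLi_cons_x p v, coeff_mul_integ, ← truncLi_cons_x, ex]; ring
        · rw [truncLi_cons_x p v, coeff_mul_integ, ← truncLi_cons_y, ey]; ring
      | y =>
        refine ⟨⟨wx', gx', by omega, fun p _ => ?_⟩, ⟨wy', gy', by omega, fun p _ => ?_⟩⟩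
        · rw [truncLi_cons_y p v, coeff_mul_integ, ← truncLi_cons_x,
            coeff_trunc_geom_mul_mul p _ _ (coeff_zero_truncLi p (List.cons_ne_nil _ _))
              (coeff_zero_truncLi p hv'), ex', pow_succ]; ring
        · rw [truncLi_cons_y p v, coeff_mul_integ, ← truncLi_cons_y,
            coeff_trunc_geom_mul_mul p _ _ (coeff_zero_truncLi p (List.cons_ne_nil _ _))
              (coeff_zero_truncLi p hv'), ey', pow_succ]; ring

/-! ### Indices and words -/

section IndexSums

variable (p : ℕ)

theorem coeff_integ_pow (f : (ZMod p)[X]) (a n : ℕ) :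
    ((integ p ^ a) f).coeff n = (n : ZMod p)⁻¹ ^ a * f.coeff n := by
  induction a with
  | zero => simp
  | succ a ih => rw [pow_succ', Module.End.mul_apply, coeff_integ, ih, pow_succ']; ring

theorem liWord_z_append (a : ℕ+) (w : List Letter) :
    liWord p (z a ++ w) = (integ p ^ (a : ℕ)) (geom p * liWord p w) := by
  have : ∀ n : ℕ, liWord p (List.replicate n Letter.x ++ ([Letter.y] ++ w)) =
      (integ p ^ (n + 1)) (geom p * liWord p w) := by
    intro n
    induction n with
    | zero => rw [zero_add, pow_one]; rfl
    | succ n ih =>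
      rw [List.replicate_succ, List.cons_append, liWord, letterFactor, one_mul, ih,
        pow_succ' _ (n + 1), Module.End.mul_apply]
  rw [z, List.append_assoc, this, Nat.sub_add_cancel a.pos]

/-- The finite multiple polylogarithm with all partial sums shifted by `m`. -/
noncomputable def shiftLi : Index → ℕ → (ZMod p)[X]
  | [], m => X ^ m
  | a :: k, m => ∑ l ∈ Finset.Ioo 0 p, C ((m + l : ℕ) : ZMod p)⁻¹ ^ (a : ℕ) * shiftLi k (m + l)

/-- `shiftLi` sums over `l_1` first, as the tuples do, whereas words begin with `k_r`. The outermost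
sum over `l_r` is multiplication by `geom`, and since the full partial sum is the exponent of `X`,
dividing by its `a`-th power is `integ ^ a`. -/
theorem shiftLi_append (k : Index) (a : ℕ+) (m : ℕ) :
    shiftLi p (k ++ [a]) m = (integ p ^ (a : ℕ)) (geom p * shiftLi p k m) := by
  induction k generalizing m with
  | nil =>
    simp only [List.nil_append, shiftLi]
    rw [geom, Finset.sum_mul, map_sum]
    refine Finset.sum_congr rfl fun l _ => ?_
    ext n
    rw [← C_pow, coeff_C_mul, coeff_integ_pow, ← pow_add, coeff_X_pow, coeff_X_pow, add_comm l m]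
    split_ifs with h
    · rw [h]
    · simp
  | cons b k ih =>
    simp only [List.cons_append, shiftLi, ih]
    rw [Finset.mul_sum, map_sum]
    refine Finset.sum_congr rfl fun l _ => ?_
    rw [← C_pow, mul_left_comm, ← smul_eq_C_mul, ← smul_eq_C_mul, map_smul]

theorem indexWord_append (k : Index) (a : ℕ+) : indexWord (k ++ [a]) = z a ++ indexWord k := by
  simp [indexWord]

theorem liWord_indexWord (k : Index) : liWord p (indexWord k) = shiftLi p k 0 := by
  induction k using List.reverseRecOn with
  | nil => simp [indexWord, liWord, shiftLi]
  | append_singleton k a ih => rw [indexWord_append, liWord_z_append, shiftLi_append, ih]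

theorem partialSum_cons_zero {r : ℕ} (a : ℕ) (l : Fin r → ℕ) :
    partialSum (Fin.cons a l : Fin (r + 1) → ℕ) 0 = a := by
  have : Finset.Iic (0 : Fin (r + 1)) = {0} := by
    ext i; simp
  rw [partialSum, this, Finset.sum_singleton, Fin.cons_zero]

theorem partialSum_cons_succ {r : ℕ} (a : ℕ) (l : Fin r → ℕ) (i : Fin r) :
    partialSum (Fin.cons a l : Fin (r + 1) → ℕ) i.succ = a + partialSum l i := by
  have h : ∀ {s : ℕ} (f : Fin s → ℕ) (i : Fin s), partialSum f i = ∑ j, if j ≤ i then f j else 0 := by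
    intro s f i
    rw [partialSum, ← Finset.sum_filter]
    congr 1
    ext j; simp
  rw [h, h, Fin.sum_univ_succ]
  simp

theorem sum_box_succ {M : Type*} [AddCommMonoid M] (r : ℕ) (f : (Fin (r + 1) → ℕ) → M) :
    ∑ l ∈ box (r + 1) p, f l =
      ∑ a ∈ Finset.Ioo 0 p, ∑ l ∈ box r p, f (Fin.cons a l) := by
  rw [← Finset.sum_product']
  refine Finset.sum_nbij' (fun l => (l 0, Fin.tail l)) (fun x => Fin.cons x.1 x.2) ?_ ?_ ?_ ?_ ?_
  · intro l hl
    rw [box, Fintype.mem_piFinset] at hl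
    rw [Finset.mem_product, box, Fintype.mem_piFinset]
    exact ⟨hl 0, fun i => hl i.succ⟩
  · intro x hx
    rw [Finset.mem_product, box, Fintype.mem_piFinset] at hx
    rw [box, Fintype.mem_piFinset]
    intro i
    refine Fin.cases ?_ (fun i => ?_) i
    · simpa using hx.1
    · simpa using hx.2 i
  · intro l _; simp
  · intro x _; simp
  · intro l _; simp

theorem shiftLi_eq_sum [Fact p.Prime] (k : Index) (m : ℕ) :
    shiftLi p k m = ∑ l ∈ box k.length p,
      C ((∏ i, (m + partialSum l i) ^ (k.get i : ℕ) : ℕ) : ZMod p)⁻¹ * X ^ (m + ∑ i, l i) := by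
  induction k generalizing m with
  | nil => simp [shiftLi, box]
  | cons a k ih =>
    refine Eq.trans ?_ (sum_box_succ p k.length _).symm
    rw [shiftLi]
    refine Finset.sum_congr rfl fun b _ => ?_
    rw [ih, Finset.mul_sum]
    refine Finset.sum_congr rfl fun l _ => ?_
    have e1 : ∏ i : Fin (k.length + 1), (m + partialSum (Fin.cons b l : Fin (k.length + 1) → ℕ) i) ^
        (((a :: k).get i : ℕ+) : ℕ) =
        (m + b) ^ (a : ℕ) * ∏ i, (m + b + partialSum l i) ^ (k.get i : ℕ) := by
      rw [Fin.prod_univ_succ, partialSum_cons_zero]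
      simp only [partialSum_cons_succ, add_assoc]
      rfl
    have e2 : ∑ i : Fin (k.length + 1), (Fin.cons b l : Fin (k.length + 1) → ℕ) i =
        b + ∑ i, l i := by
      rw [Fin.sum_univ_succ, Fin.cons_zero]; simp only [Fin.cons_succ]
    refine Eq.trans ?_ (congrArg₂ (fun x y : ℕ => C (x : ZMod p)⁻¹ * X ^ (m + y)) e1 e2).symm
    rw [← add_assoc, ← mul_assoc, ← C_pow, ← C_mul, Nat.cast_mul, mul_inv, Nat.cast_pow,
      inv_pow]

theorem liWord_indexWord_eq_sum [Fact p.Prime] (k : Index) :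
    liWord p (indexWord k) =
      ∑ l ∈ box k.length p, C (denom k l : ZMod p)⁻¹ * X ^ ∑ i, l i := by
  rw [liWord_indexWord, shiftLi_eq_sum]
  simp only [zero_add, denom]

/-- The restriction to denominators prime to `p` is automatic, as `0⁻¹ = 0` in `ZMod p`. -/
theorem liWord_indexWord_eq_filter_sum [Fact p.Prime] (k : Index) :
    liWord p (indexWord k) = ∑ l ∈ box k.length p with (denom k l).Coprime p,
      C (denom k l : ZMod p)⁻¹ * X ^ ∑ i, l i := by
  rw [liWord_indexWord_eq_sum, Finset.sum_filter_of_ne]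
  intro l _ h
  by_contra hc
  apply h
  have : (denom k l : ZMod p) = 0 := by
    rw [ZMod.natCast_eq_zero_iff]
    by_contra hd
    exact hc (((Fact.out : p.Prime).coprime_iff_not_dvd.mpr hd).symm)
  rw [this, inv_zero, C_0, zero_mul]

theorem trunc_X_pow (n : ℕ) : trunc p (X ^ n) = if n < p then X ^ n else 0 := by
  ext i
  rw [coeff_trunc, apply_ite (fun f : (ZMod p)[X] => f.coeff i), coeff_X_pow, coeff_zero]
  split_ifs <;> first | rfl | omega

theorem eval_truncLi_indexWord [Fact p.Prime] (k : Index) :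
    (truncLi p (indexWord k)).eval 1 =
      ∑ l ∈ box k.length p with ∑ i, l i < p, (denom k l : ZMod p)⁻¹ := by
  rw [truncLi, liWord_indexWord_eq_sum, map_sum, eval_finsetSum, Finset.sum_filter]
  refine Finset.sum_congr rfl fun l _ => ?_
  rw [← smul_eq_C_mul, map_smul, trunc_X_pow]
  split_ifs <;> simp

/-- The sum of `1 / (n_1 ^ k_1 ⋯ n_r ^ k_r)` over `m < n_1 < ⋯ < n_r < p`. -/
noncomputable def tailSum : Index → ℕ → ZMod p
  | [], _ => 1
  | a :: k, m => ∑ n ∈ Finset.Ioo m p, (n : ZMod p)⁻¹ ^ (a : ℕ) * tailSum k n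

/-- The substitution `n_i = m + l_1 + ⋯ + l_i` turns tuples of bounded sum into chains `m < n_1 < ⋯
< n_r < p`, the form suited to the stuffle product. For `m ≥ p` truncation removes everything. -/
theorem eval_trunc_shiftLi (k : Index) (m : ℕ) :
    (trunc p (shiftLi p k m)).eval 1 = if m < p then tailSum p k m else 0 := by
  induction k generalizing m with
  | nil => rw [shiftLi, trunc_X_pow]; split_ifs <;> simp [tailSum]
  | cons a k ih =>
    rw [shiftLi, map_sum, eval_finsetSum]
    have h1 : ∀ l, eval 1 (trunc p (C ((m + l : ℕ) : ZMod p)⁻¹ ^ (a : ℕ) * shiftLi p k (m + l))) =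
        if m + l < p then ((m + l : ℕ) : ZMod p)⁻¹ ^ (a : ℕ) * tailSum p k (m + l) else 0 := by
      intro l
      rw [← C_pow, ← smul_eq_C_mul, map_smul, eval_smul, ih, smul_eq_mul, mul_ite, mul_zero]
    simp only [h1]
    split_ifs with hm
    · rw [← Finset.sum_filter, tailSum]
      refine Finset.sum_nbij' (fun l => m + l) (fun n => n - m) ?_ ?_ ?_ ?_ ?_
      · intro l hl
        simp only [Finset.mem_filter, Finset.mem_Ioo] at hl ⊢
        omega
      · intro n hn
        simp only [Finset.mem_filter, Finset.mem_Ioo] at hn ⊢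
        omega
      · intro l _; simp
      · intro n hn
        simp only [Finset.mem_Ioo] at hn
        omega
      · intro l _; rfl
    · refine Finset.sum_eq_zero fun l _ => if_neg (by omega)

end IndexSums

/-! ### Additive maps on families modulo finitely many primes -/

section AlmostAll

variable {R S : {p : ℕ // p.Prime} → Type} [∀ p, CommRing (R p)] [∀ p, CommRing (S p)]
  [∀ p : {p : ℕ // p.Prime}, Algebra (ZMod p) (R p)]
  [∀ p : {p : ℕ // p.Prime}, Algebra (ZMod p) (S p)]

/-- The class of a family. -/
abbrev germ (f : ∀ p, R p) : AlmostAll R := Ideal.Quotient.mk (finiteSupport R) f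

omit [∀ p : {p : ℕ // p.Prime}, Algebra (ZMod p) (R p)] in
theorem exists_germ (f : AlmostAll R) : ∃ g : ∀ p, R p, germ g = f :=
  Ideal.Quotient.mk_surjective f

/-- The linear map induced by a family of additive maps. -/
noncomputable def mapGerm (φ : ∀ p, R p →+ S p) : AlmostAll R →ₗ[ℚ] AlmostAll S :=
  AddMonoidHom.toRatLinearMap <|
    QuotientAddGroup.map (finiteSupport R).toAddSubgroup (finiteSupport S).toAddSubgroup
      { toFun := fun f p => φ p (f p)
        map_zero' := funext fun p => map_zero (φ p)
        map_add' := fun f g => funext fun p => map_add (φ p) _ _ }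
      (fun f hf => Set.Finite.subset hf fun p hp h => hp (by
        change φ p (f p) = 0
        rw [h, map_zero]))

end AlmostAll

/-! ### The stuffle product of finite multiple zeta values -/

/-- Families of functions of an integer. -/
abbrev FunA : Type := AlmostAll fun p => ℕ → ZMod p

/-- The operator `F ↦ (m ↦ ∑_{m < n < p} F(n) / n ^ a)`. -/
noncomputable def tailOp (a : ℕ+) : FunA →ₗ[ℚ] FunA :=
  mapGerm fun p =>
    { toFun := fun F m => ∑ n ∈ Finset.Ioo m (p : ℕ), (n : ZMod p)⁻¹ ^ (a : ℕ) * F n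
      map_zero' := by funext m; simp
      map_add' := fun F G => by funext m; simp [mul_add, Finset.sum_add_distrib] }

/-- Split the square of pairs `(n, n')` into `n < n'`, `n > n'` and the diagonal. -/
theorem sum_Ioo_mul_sum_Ioo {R : Type*} [CommRing R] (f g : ℕ → R) (m p : ℕ) :
    (∑ n ∈ Finset.Ioo m p, f n) * ∑ n ∈ Finset.Ioo m p, g n =
      ∑ n ∈ Finset.Ioo m p, f n * ∑ n' ∈ Finset.Ioo n p, g n' +
      ∑ n ∈ Finset.Ioo m p, g n * ∑ n' ∈ Finset.Ioo n p, f n' +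
      ∑ n ∈ Finset.Ioo m p, f n * g n := by
  have h1 : ∀ f g : ℕ → R, ∑ n ∈ Finset.Ioo m p, f n * ∑ n' ∈ Finset.Ioo n p, g n' =
      ∑ n ∈ Finset.Ioo m p, ∑ n' ∈ Finset.Ioo m p, if n < n' then f n * g n' else 0 := by
    intro f g
    refine Finset.sum_congr rfl fun n hn => ?_
    rw [Finset.mul_sum, ← Finset.sum_filter]
    refine Finset.sum_congr ?_ fun _ _ => rfl
    ext n'
    simp only [Finset.mem_filter, Finset.mem_Ioo] at hn ⊢
    omega
  have h2 : ∑ n ∈ Finset.Ioo m p, f n * g n =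
      ∑ n ∈ Finset.Ioo m p, ∑ n' ∈ Finset.Ioo m p, if n = n' then f n * g n' else 0 := by
    refine Finset.sum_congr rfl fun n hn => ?_
    rw [Finset.sum_ite_eq, if_pos hn]
  rw [h1, h1, h2, Finset.sum_comm (f := fun n n' => if n < n' then g n * f n' else 0),
    Finset.sum_mul_sum, ← Finset.sum_add_distrib, ← Finset.sum_add_distrib]
  refine Finset.sum_congr rfl fun n _ => ?_
  rw [← Finset.sum_add_distrib, ← Finset.sum_add_distrib]
  refine Finset.sum_congr rfl fun n' _ => ?_
  rcases lt_trichotomy n n' with h | h | h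
  · rw [if_pos h, if_neg (by omega), if_neg (by omega), add_zero, add_zero]
  · rw [if_neg (by omega), if_neg (by omega), if_pos h, zero_add, zero_add]
  · rw [if_neg (by omega), if_pos h, if_neg (by omega), add_zero, zero_add, mul_comm]

theorem tailOp_mul_tailOp (a b : ℕ+) (F G : FunA) :
    tailOp a F * tailOp b G =
      tailOp a (F * tailOp b G) + tailOp b (tailOp a F * G) + tailOp (a + b) (F * G) := by
  obtain ⟨F, rfl⟩ := exists_germ F
  obtain ⟨G, rfl⟩ := exists_germ G
  refine congrArg germ (funext fun p => funext fun m => ?_)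
  refine (sum_Ioo_mul_sum_Ioo _ _ m p).trans ?_
  refine congrArg₂ _ (congrArg₂ _ ?_ ?_) ?_ <;> refine Finset.sum_congr rfl fun n _ => ?_
  · exact mul_assoc _ _ _
  · exact (mul_assoc _ _ _).trans (congrArg _ (mul_comm _ _))
  · change _ = _ ^ ((a + b : ℕ+) : ℕ) * (F p n * G p n)
    rw [PNat.add_coe, pow_add]
    ring

/-- The family of the functions `tailSum`. -/
noncomputable def tailFun (k : Index) : FunA := germ fun p => tailSum p k

/-- Prepending `a` to an index is `tailOp a`, and `tailOp_mul_tailOp` is exactly the recursion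
defining `stuffle`. The sums must be kept as functions of the lower bound `m` for this induction; `m
= 0` gives zeta values. -/
theorem tailFun_mul (k l : Index) :
    tailFun k * tailFun l = Finsupp.linearCombination ℚ tailFun (stuffle k l) := by
  have hp : ∀ a f, Finsupp.linearCombination ℚ tailFun (prepend a f) =
      tailOp a (Finsupp.linearCombination ℚ tailFun f) := by
    intro a f
    induction f using Finsupp.induction_linear with
    | zero => simp
    | add f g hf hg => simp only [map_add, hf, hg]
    | single k c =>
      rw [prepend_single, Finsupp.linearCombination_single, Finsupp.linearCombination_single,
        map_smul]
      rfl
  have h1 : tailFun [] = 1 := rfl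
  induction k, l using stuffle.induct with
  | case1 w => simp [stuffle_nil_left, h1]
  | case2 a u => simp [stuffle_nil_right, h1]
  | case3 a u b v ih1 ih2 ih3 =>
    rw [stuffle_cons, one_smul, map_add, map_add, hp, hp, hp, ← ih1, ← ih2, ← ih3]
    exact tailOp_mul_tailOp a b (tailFun u) (tailFun v)

/-- Evaluation at `0`. -/
noncomputable def evalZero : FunA →+* A :=
  Ideal.quotientMap (finiteSupport fun p => ZMod p)
    (RingHom.pi fun p => (Pi.evalRingHom (fun _ : ℕ => ZMod p) 0).comp
      (Pi.evalRingHom (fun p : {p : ℕ // p.Prime} => ℕ → ZMod p) p))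
    (fun f hf => Set.Finite.subset hf fun p hp h => hp (by
      change f p 0 = 0
      rw [h, Pi.zero_apply]))

theorem zetaA_eq (k : Index) : zetaA k = germ fun p => (truncLi p (indexWord k)).eval 1 :=
  congrArg germ (funext fun p =>
    haveI : Fact (p : ℕ).Prime := ⟨p.2⟩
    (eval_truncLi_indexWord p k).symm)

theorem evalZero_tailFun (k : Index) : evalZero (tailFun k) = zetaA k := by
  rw [zetaA_eq]
  refine congrArg germ (funext fun p => ?_)
  rw [truncLi, liWord_indexWord, eval_trunc_shiftLi, if_pos p.2.pos]
  rfl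

theorem zetaA_mul (k l : Index) :
    zetaA k * zetaA l = Finsupp.linearCombination ℚ zetaA (stuffle k l) := by
  rw [← evalZero_tailFun, ← evalZero_tailFun, ← map_mul, tailFun_mul]
  have : ∀ f, evalZero (Finsupp.linearCombination ℚ tailFun f) =
      Finsupp.linearCombination ℚ zetaA f := by
    intro f
    have h2 := Finsupp.apply_linearCombination ℚ (evalZero.toRatAlgHom.toLinearMap) tailFun f
    refine h2.trans ?_
    congr 2
    funext k
    exact evalZero_tailFun k
  exact this _

theorem li_eq (k : Index) : li k = germ fun p => liWord p (indexWord k) :=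
  congrArg germ (funext fun p =>
    haveI : Fact (p : ℕ).Prime := ⟨p.2⟩
    (liWord_indexWord_eq_filter_sum p k).symm)

/-! ### Polylogarithms of words and the filtration -/

/-- The operator `integ` on `ℬ`. -/
noncomputable def integB : B →ₗ[ℚ] B := mapGerm fun p => (integ p).toAddMonoidHom

/-- The operator `projTp` on `ℬ`. -/
noncomputable def projB : B →ₗ[ℚ] B := mapGerm fun p => (projTp p).toAddMonoidHom

/-- The factor in `ℬ` attached to a letter. -/
noncomputable def factorB (a : Letter) : B := germ fun p => letterFactor p a

/-- The finite multiple polylogarithm in `ℬ` attached to a word. -/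
noncomputable def liB (w : List Letter) : B := germ fun p => liWord p w

/-- The truncated finite multiple polylogarithm in `ℬ` attached to a word. -/
noncomputable def truncB (w : List Letter) : B := germ fun p => truncLi p w

/-- The finite multiple zeta value attached to a word. -/
noncomputable def zetaWord (w : List Letter) : A := germ fun p => (truncLi p w).eval 1

/-- The operator on `ℬ` which prepends a letter to the word of a polylogarithm. -/
noncomputable def letterOp (a : Letter) : B →ₗ[ℚ] B := integB ∘ₗ LinearMap.mulLeft ℚ (factorB a)

theorem letterOp_apply (a : Letter) (f : B) : letterOp a f = integB (factorB a * f) := rfl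

theorem liB_cons (a : Letter) (w : List Letter) : liB (a :: w) = letterOp a (liB w) := rfl

theorem liB_nil : liB [] = 1 := rfl

theorem factorB_x : factorB Letter.x = 1 := rfl

theorem letterOp_x (f : B) : letterOp Letter.x f = integB f := by
  rw [letterOp_apply, factorB_x, one_mul]

theorem li_eq_liB (k : Index) : li k = liB (indexWord k) := li_eq k

theorem zetaA_eq_zetaWord (k : Index) : zetaA k = zetaWord (indexWord k) := zetaA_eq k

theorem integB_constB_mul (c : A) (f : B) : integB (constB c * f) = constB c * integB f := by
  obtain ⟨c, rfl⟩ := exists_germ c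
  obtain ⟨f, rfl⟩ := exists_germ f
  exact congrArg germ (funext fun p => integ_C_mul p (c p) (f p))

theorem projB_constB_mul (c : A) (f : B) : projB (constB c * f) = constB c * projB f := by
  obtain ⟨c, rfl⟩ := exists_germ c
  obtain ⟨f, rfl⟩ := exists_germ f
  exact congrArg germ (funext fun p => projTp_C_mul p (c p) (f p))

theorem integB_Tp_mul (f : B) : integB (Tp * f) = Tp * integB f := by
  obtain ⟨f, rfl⟩ := exists_germ f
  exact congrArg germ (funext fun p => integ_Xp_mul p (f p))

theorem projB_Tp_mul (f : B) : projB (Tp * f) = Tp * projB f := by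
  obtain ⟨f, rfl⟩ := exists_germ f
  exact congrArg germ (funext fun p => projTp_Xp_mul p (f p))

theorem integB_coeff_mul (c : A) (n : ℕ) (f : B) :
    integB (constB c * Tp ^ n * f) = constB c * Tp ^ n * integB f := by
  rw [mul_assoc, integB_constB_mul, mul_assoc]
  congr 1
  induction n generalizing f with
  | zero => simp
  | succ n ih => rw [pow_succ, mul_assoc, ih, integB_Tp_mul, mul_assoc]

theorem projB_coeff_mul (c : A) (n : ℕ) (f : B) :
    projB (constB c * Tp ^ n * f) = constB c * Tp ^ n * projB f := by
  rw [mul_assoc, projB_constB_mul, mul_assoc]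
  congr 1
  induction n generalizing f with
  | zero => simp
  | succ n ih => rw [pow_succ, mul_assoc, ih, projB_Tp_mul, mul_assoc]

theorem letterOp_coeff_mul (a : Letter) (c : A) (n : ℕ) (f : B) :
    letterOp a (constB c * Tp ^ n * f) = constB c * Tp ^ n * letterOp a f := by
  rw [letterOp_apply, mul_left_comm, integB_coeff_mul, letterOp_apply]

theorem integB_one : integB 1 = 0 := congrArg germ (funext fun p => integ_one p)

theorem projB_integB (f : B) : projB (integB f) = 0 := by
  obtain ⟨f, rfl⟩ := exists_germ f
  exact congrArg germ (funext fun p => projTp_integ p (f p))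

theorem integB_mul_integB (f g : B) :
    integB f * integB g = integB (f * integB g) + integB (integB f * g) -
      projB f * integB (integB g) - projB g * integB (integB f) +
      projB (integB f * integB g) := by
  obtain ⟨f, rfl⟩ := exists_germ f
  obtain ⟨g, rfl⟩ := exists_germ g
  exact congrArg germ (funext fun p =>
    haveI : Fact (p : ℕ).Prime := ⟨p.2⟩
    integ_mul_integ p (f p) (g p))

/-! ### Spans of finite multiple zeta values -/

theorem length_indexWord (k : Index) : (indexWord k).length = wt k := by
  induction k with
  | nil => rfl
  | cons a k ih =>
    have := a.pos
    rw [indexWord_cons, List.length_append, ih]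
    simp only [z, wt, List.length_append, List.length_replicate, List.length_singleton,
      List.map_cons, List.sum_cons]
    omega

/-- The span of the finite multiple zeta values of weight `c`. -/
noncomputable def zetaSpan (c : ℕ) : Submodule ℚ A := Submodule.span ℚ {x | ∃ k, wt k = c ∧ x = zetaA k}

theorem zetaA_mem (k : Index) : zetaA k ∈ zetaSpan (wt k) := Submodule.subset_span ⟨k, rfl, rfl⟩

theorem zetaWord_mem {w : List Letter} (hw : Good w) : zetaWord w ∈ zetaSpan w.length := by
  obtain ⟨k, rfl⟩ := hw.exists_index
  rw [← zetaA_eq_zetaWord, length_indexWord]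
  exact zetaA_mem k

theorem linearCombination_mem {X M : Type*} [AddCommGroup M] [Module ℚ M] (g : X → M)
    (S : Submodule ℚ M) (f : X →₀ ℚ) (h : ∀ x ∈ f.support, g x ∈ S) :
    Finsupp.linearCombination ℚ g f ∈ S := by
  rw [Finsupp.linearCombination_apply]
  exact Submodule.sum_mem _ fun x hx => Submodule.smul_mem _ _ (h x hx)

theorem support_prepend {α : Type} (a : α) (f : List α →₀ ℚ) (w : List α)
    (hw : w ∈ (prepend a f).support) : ∃ w' ∈ f.support, w = a :: w' := by
  classical
  have := Finsupp.mapDomain_support hw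
  rw [Finset.mem_image] at this
  obtain ⟨w', h1, h2⟩ := this
  exact ⟨w', h1, h2.symm⟩

theorem wt_cons (a : ℕ+) (k : Index) : wt (a :: k) = a + wt k := rfl

theorem wt_of_mem_support_stuffle (k l m : Index) (hm : m ∈ (stuffle k l).support) :
    wt m = wt k + wt l := by
  classical
  induction k, l using stuffle.induct generalizing m with
  | case1 w =>
    rw [stuffle_nil_left] at hm
    rw [Finset.mem_singleton.mp (Finsupp.support_single_subset hm)]
    simp [wt]
  | case2 a u =>
    rw [stuffle_nil_right] at hm
    rw [Finset.mem_singleton.mp (Finsupp.support_single_subset hm)]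
    simp [wt]
  | case3 a u b v ih1 ih2 ih3 =>
    rw [stuffle_cons, one_smul] at hm
    rw [wt_cons, wt_cons]
    rcases Finset.mem_union.mp (Finsupp.support_add hm) with h | h
    · rcases Finset.mem_union.mp (Finsupp.support_add h) with h | h
      · obtain ⟨w, hw, rfl⟩ := support_prepend _ _ _ h
        rw [wt_cons, ih1 w hw, wt_cons]; ring
      · obtain ⟨w, hw, rfl⟩ := support_prepend _ _ _ h
        rw [wt_cons, ih2 w hw, wt_cons]; ring
    · obtain ⟨w, hw, rfl⟩ := support_prepend _ _ _ h
      rw [wt_cons, ih3 w hw, PNat.add_coe]; ring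

theorem wt_of_mem_support_shuffle (k l m : Index) (hm : m ∈ (shuffle k l).support) :
    wt m = wt k + wt l := by
  have : indexWord m ∈ (shuffleWord (indexWord k) (indexWord l)).support := by
    rw [shuffle, Finsupp.comapDomain_support, Finset.mem_preimage] at hm
    exact hm
  have := (shuffleWord_support _ _ (good_indexWord k) (good_indexWord l) _ this).2
  rwa [length_indexWord, length_indexWord, length_indexWord] at this

theorem zetaSpan_mul {c d : ℕ} {x y : A} (hx : x ∈ zetaSpan c) (hy : y ∈ zetaSpan d) :
    x * y ∈ zetaSpan (c + d) := by
  have h1 : ∀ k : Index, wt k = c → ∀ y ∈ zetaSpan d, zetaA k * y ∈ zetaSpan (c + d) := by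
    intro k hk y hy
    have : zetaSpan d ≤ (zetaSpan (c + d)).comap (LinearMap.mulLeft ℚ (zetaA k)) := by
      refine Submodule.span_le.mpr ?_
      rintro _ ⟨l, hl, rfl⟩
      change zetaA k * zetaA l ∈ zetaSpan (c + d)
      rw [zetaA_mul]
      refine linearCombination_mem _ _ _ fun m hm => ?_
      have := wt_of_mem_support_stuffle k l m hm
      rw [← hk, ← hl, ← this]
      exact zetaA_mem m
    exact this hy
  have : zetaSpan c ≤ (zetaSpan (c + d)).comap (LinearMap.mulRight ℚ y) := by
    refine Submodule.span_le.mpr ?_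
    rintro _ ⟨k, hk, rfl⟩
    exact h1 k hk y hy
  exact this hx

theorem one_mem_zetaSpan : (1 : A) ∈ zetaSpan 0 := by
  rw [← zetaA_nil]
  exact zetaA_mem []

/-! ### The spaces `ℛ_{a,b}` -/

theorem Rab_le {a b : ℕ} {S : Submodule ℚ B}
    (h : ∀ (k k' : Index) (n : ℕ), wt k + wt k' = a → wt k' ≤ b →
      constB (zetaA k) * Tp ^ n * li k' ∈ S) : Rab a b ≤ S := by
  refine Submodule.span_le.mpr ?_
  rintro _ ⟨k, k', n, h1, h2, rfl⟩
  exact h k k' n h1 h2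

theorem Rab_mono {a b b' : ℕ} (h : b ≤ b') : Rab a b ≤ Rab a b' :=
  Rab_le fun k k' n h1 h2 => Submodule.subset_span ⟨k, k', n, h1, h2.trans h, rfl⟩

/-- The inclusion of `𝒜` in `ℬ` as a linear map. -/
noncomputable def constLin : A →ₗ[ℚ] B := constB.toRatAlgHom.toLinearMap

/-- Coefficients `ζ (T ^ p) ^ n` raise only the first degree: the zeta factors recombine by the
stuffle product and the polylogarithm is untouched. -/
theorem coeff_mul_mem_Rab {c d a b : ℕ} {x : A} (hx : x ∈ zetaSpan c) (n : ℕ) {f : B}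
    (hf : f ∈ Rab d b) (ha : c + d = a) : constB x * Tp ^ n * f ∈ Rab a b := by
  have : Rab d b ≤ (Rab a b).comap (LinearMap.mulLeft ℚ (constB x * Tp ^ n)) := by
    refine Rab_le fun k k' m h1 h2 => ?_
    change constB x * Tp ^ n * (constB (zetaA k) * Tp ^ m * li k') ∈ Rab a b
    have h3 := zetaSpan_mul hx (zetaA_mem k)
    have e : constB x * Tp ^ n * (constB (zetaA k) * Tp ^ m * li k') =
        constB (x * zetaA k) * (Tp ^ (n + m) * li k') := by
      rw [map_mul, pow_add]; ring
    rw [e]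
    have h4 : zetaSpan (c + wt k) ≤
        (Rab a b).comap (LinearMap.mulRight ℚ (Tp ^ (n + m) * li k') ∘ₗ constLin) := by
      refine Submodule.span_le.mpr ?_
      rintro _ ⟨l, hl, rfl⟩
      exact Submodule.subset_span ⟨l, k', n + m, by omega, h2, by
        change constB (zetaA l) * (Tp ^ (n + m) * li k') = _
        rw [mul_assoc]⟩
    exact h4 h3
  exact this hf

theorem liB_mem_Rab {w : List Letter} (hw : Good w) : liB w ∈ Rab w.length w.length := by
  obtain ⟨k, rfl⟩ := hw.exists_index
  rw [length_indexWord, ← li_eq_liB]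
  exact Submodule.subset_span ⟨[], k, 0, by simp [wt], le_rfl, by simp [zetaA_nil]⟩

theorem one_mem_Rab_zero (b : ℕ) : (1 : B) ∈ Rab 0 b := Rab_mono (Nat.zero_le b) one_mem_Rab

theorem coeff_mem_Rab {c : ℕ} {x : A} (hx : x ∈ zetaSpan c) (n b : ℕ) :
    constB x * Tp ^ n ∈ Rab c b := by
  have := coeff_mul_mem_Rab hx n (one_mem_Rab_zero b) (add_zero c)
  rwa [mul_one] at this

theorem Rab_zero_mul {c d b : ℕ} {f g : B} (hf : f ∈ Rab c 0) (hg : g ∈ Rab d b) :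
    f * g ∈ Rab (c + d) b := by
  have : Rab c 0 ≤ (Rab (c + d) b).comap (LinearMap.mulRight ℚ g) := by
    refine Rab_le fun k k' n h1 h2 => ?_
    have hk' : k' = [] := by
      cases k' with
      | nil => rfl
      | cons a k' =>
        have := a.pos
        rw [wt_cons] at h2
        omega
    subst hk'
    change constB (zetaA k) * Tp ^ n * li [] * g ∈ Rab (c + d) b
    rw [li_nil, mul_one]
    exact coeff_mul_mem_Rab (zetaA_mem k) n hg (by rw [← h1]; simp [wt])
  exact this hf

theorem letterOp_mem_Rab (a : Letter) {c b : ℕ} {f : B} (hf : f ∈ Rab c b) :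
    letterOp a f ∈ Rab (c + 1) (b + 1) := by
  have : Rab c b ≤ (Rab (c + 1) (b + 1)).comap (letterOp a) := by
    refine Rab_le fun k k' n h1 h2 => ?_
    change letterOp a _ ∈ Rab (c + 1) (b + 1)
    rw [letterOp_coeff_mul, li_eq_liB]
    -- The word `x` alone comes from no index, but its polylogarithm is the integral of `1`, which
    -- is zero.
    by_cases h : a = Letter.x ∧ indexWord k' = []
    · rw [h.1, h.2, letterOp_x, liB_nil, integB_one, mul_zero]
      exact Submodule.zero_mem _
    · rw [← liB_cons]
      have hg : Good (a :: indexWord k') := by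
        by_cases h0 : indexWord k' = []
        · cases a with
          | x => exact absurd ⟨rfl, h0⟩ h
          | y => exact (good_indexWord k').cons_y
        · exact (good_indexWord k').cons _ h0
      have hl : (a :: indexWord k').length = wt k' + 1 := by
        rw [List.length_cons, length_indexWord]
      exact Rab_mono (by omega)
        (coeff_mul_mem_Rab (zetaA_mem k) n (liB_mem_Rab hg) (by omega))
  exact this hf

/-! ### Expansion in truncated polylogarithms -/

/-- The span of the products of coefficients and truncated polylogarithms, of total weight `a`. -/
noncomputable def truncSpan (a : ℕ) : Submodule ℚ B :=
  Submodule.span ℚ {f | ∃ (c : ℕ) (x : A) (n : ℕ) (w : List Letter), x ∈ zetaSpan c ∧ Good w ∧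
    w ≠ [] ∧ c + w.length = a ∧ f = constB x * Tp ^ n * truncB w}

theorem truncSpan_le {a : ℕ} {S : Submodule ℚ B}
    (h : ∀ (c : ℕ) (x : A) (n : ℕ) (w : List Letter), x ∈ zetaSpan c → Good w →
    w ≠ [] → c + w.length = a → constB x * Tp ^ n * truncB w ∈ S) : truncSpan a ≤ S := by
  refine Submodule.span_le.mpr ?_
  rintro _ ⟨c, x, n, w, h1, h2, h3, h4, rfl⟩
  exact h c x n w h1 h2 h3 h4

theorem mem_truncSpan {a c : ℕ} {x : A} (hx : x ∈ zetaSpan c) (n : ℕ) {w : List Letter}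
    (hg : Good w) (hw : w ≠ []) (ha : c + w.length = a) :
    constB x * Tp ^ n * truncB w ∈ truncSpan a :=
  Submodule.subset_span ⟨c, x, n, w, hx, hg, hw, ha, rfl⟩

theorem letterOp_x_truncB (w : List Letter) : letterOp Letter.x (truncB w) = truncB (Letter.x :: w) := by
  rw [letterOp_x]
  exact congrArg germ (funext fun p => (truncLi_cons_x p w).symm)

theorem letterOp_y_truncB {w : List Letter} (hw : w ≠ []) :
    letterOp Letter.y (truncB w) = truncB (Letter.y :: w) - Tp * truncB (Letter.y :: w) +
      Tp * (constB (zetaWord w) * truncB [Letter.y]) - Tp * truncB (Letter.x :: w) :=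
  congrArg germ (funext fun p =>
    haveI : Fact (p : ℕ).Prime := ⟨p.2⟩
    integ_geom_mul_truncLi p hw)

theorem letterOp_mem_truncSpan (a : Letter) {c : ℕ} {f : B} (hf : f ∈ truncSpan c) :
    letterOp a f ∈ truncSpan (c + 1) := by
  have : truncSpan c ≤ (truncSpan (c + 1)).comap (letterOp a) := by
    refine truncSpan_le fun d x n w hx hg hw hc => ?_
    change letterOp a _ ∈ truncSpan (c + 1)
    rw [letterOp_coeff_mul]
    have hl : ∀ a : Letter, d + (a :: w).length = c + 1 := fun a => by
      rw [List.length_cons]; omega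
    cases a with
    | x =>
      rw [letterOp_x_truncB]
      exact mem_truncSpan hx n (hg.cons _ hw) (List.cons_ne_nil _ _) (hl _)
    | y =>
      have e : constB x * Tp ^ n * letterOp Letter.y (truncB w) =
          constB x * Tp ^ n * truncB (Letter.y :: w) - constB x * Tp ^ (n + 1) * truncB (Letter.y :: w)
          + constB (x * zetaWord w) * Tp ^ (n + 1) * truncB [Letter.y]
          - constB x * Tp ^ (n + 1) * truncB (Letter.x :: w) := by
        rw [letterOp_y_truncB hw, map_mul, pow_succ]
        ring
      rw [e]
      refine Submodule.sub_mem _ (Submodule.add_mem _ (Submodule.sub_mem _ ?_ ?_) ?_) ?_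
      · exact mem_truncSpan hx n (hg.cons _ hw) (List.cons_ne_nil _ _) (hl _)
      · exact mem_truncSpan hx _ (hg.cons _ hw) (List.cons_ne_nil _ _) (hl _)
      · exact mem_truncSpan (zetaSpan_mul hx (zetaWord_mem hg)) _ (Or.inr rfl)
          (List.cons_ne_nil _ _) (by rw [List.length_singleton]; omega)
      · exact mem_truncSpan hx _ (hg.cons _ hw) (List.cons_ne_nil _ _) (hl _)
  exact this hf

theorem liB_y : liB [Letter.y] = truncB [Letter.y] :=
  congrArg germ (funext fun p => (truncLi_y p).symm)

/-- The one-letter word `y` is already truncated, because `geom` has degree below `p`, and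
`truncSpan` is stable under prepending letters. -/
theorem liB_mem_truncSpan {w : List Letter} (hg : Good w) (hw : w ≠ []) :
    liB w ∈ truncSpan w.length := by
  induction w with
  | nil => exact absurd rfl hw
  | cons a w ih =>
    rcases good_cons hg with ⟨rfl, rfl⟩ | ⟨hw', hg'⟩
    · have := mem_truncSpan one_mem_zetaSpan 0 hg hw (zero_add _)
      rw [map_one, pow_zero, one_mul, one_mul] at this
      rwa [liB_y]
    · exact letterOp_mem_truncSpan a (ih hg' hw')

theorem projB_mul_of_truncB (u v : List Letter) (hu : u ≠ []) (hv : v ≠ []) (hgu : Good u)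
    (hgv : Good v) : projB (truncB u * truncB v) ∈ Rab (u.length + v.length) 0 := by
  obtain ⟨⟨w, hw, hl, h⟩, -⟩ := exists_coeff_truncLi_mul v hv hgv u hu hgu
  have e : projB (truncB u * truncB v) = (-1) ^ v.length * (constB (zetaWord w) * Tp ^ 1) := by
    rw [pow_one]
    refine congrArg germ (funext fun p => ?_)
    have : Fact (p : ℕ).Prime := ⟨p.2⟩
    refine (projTp_mul_of_small p _ _ (fun n => coeff_truncLi_of_le p u)
      (fun n => coeff_truncLi_of_le p v) (coeff_zero_truncLi p hu)).trans ?_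
    rw [h, map_mul, map_pow, map_neg, map_one, mul_assoc]
    rfl
  have h1 := coeff_mem_Rab (zetaWord_mem hw) 1 0
  rw [e, ← hl]
  rcases neg_one_pow_eq_or B v.length with h2 | h2
  · rwa [h2, one_mul]
  · rw [h2, neg_one_mul]
    exact Submodule.neg_mem _ h1

theorem projB_mul_mem_of_truncSpan {a b : ℕ} {f g : B} (hf : f ∈ truncSpan a)
    (hg : g ∈ truncSpan b) : projB (f * g) ∈ Rab (a + b) 0 := by
  have : truncSpan a ≤ (Rab (a + b) 0).comap (projB ∘ₗ LinearMap.mulRight ℚ g) := by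
    refine truncSpan_le fun c x n u hx hgu hu hc => ?_
    have : truncSpan b ≤ (Rab (a + b) 0).comap
        (projB ∘ₗ LinearMap.mulLeft ℚ (constB x * Tp ^ n * truncB u)) := by
      refine truncSpan_le fun d y m v hy hgv hv hd => ?_
      change projB (constB x * Tp ^ n * truncB u * (constB y * Tp ^ m * truncB v)) ∈
        Rab (a + b) 0
      have e : constB x * Tp ^ n * truncB u * (constB y * Tp ^ m * truncB v) =
          constB (x * y) * Tp ^ (n + m) * (truncB u * truncB v) := by
        rw [map_mul, pow_add]; ring
      rw [e, projB_coeff_mul]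
      exact coeff_mul_mem_Rab (zetaSpan_mul hx hy) _ (projB_mul_of_truncB u v hu hv hgu hgv)
        (by omega)
    exact this hg
  exact this hf

theorem projB_liB_mul_liB {u v : List Letter} (hu : u ≠ []) (hv : v ≠ []) (hgu : Good u)
    (hgv : Good v) : projB (liB u * liB v) ∈ Rab (u.length + v.length) 0 :=
  projB_mul_mem_of_truncSpan (liB_mem_truncSpan hgu hu) (liB_mem_truncSpan hgv hv)

/-- The coefficient of `T ^ p` in `geom` times a truncated polylogarithm is the value of the latter
at `1`, a zeta value. -/
theorem projB_factorB_mul_truncB {w : List Letter} (hw : w ≠ []) :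
    projB (factorB Letter.y * truncB w) = constB (zetaWord w) * Tp ^ 1 := by
  rw [pow_one]
  refine congrArg germ (funext fun p => ?_)
  have : Fact (p : ℕ).Prime := ⟨p.2⟩
  have h0 := coeff_zero_truncLi p hw
  have := projTp_mul_of_small p (truncLi p w) (geom p) (fun n => coeff_truncLi_of_le p w)
    (fun n hn => by rw [coeff_geom, if_neg (by omega)]) h0
  rw [coeff_mul_geom p _ h0, trunc_truncLi, mul_comm] at this
  exact this

theorem projB_factorB_mul_mem {c : ℕ} {f : B} (hf : f ∈ truncSpan c) :
    projB (factorB Letter.y * f) ∈ Rab c 0 := by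
  have : truncSpan c ≤ (Rab c 0).comap (projB ∘ₗ LinearMap.mulLeft ℚ (factorB Letter.y)) := by
    refine truncSpan_le fun d x n w hx hg hw hc => ?_
    change projB (factorB Letter.y * (constB x * Tp ^ n * truncB w)) ∈ Rab c 0
    rw [mul_left_comm, projB_coeff_mul, projB_factorB_mul_truncB hw]
    exact coeff_mul_mem_Rab hx n (coeff_mem_Rab (zetaWord_mem hg) 1 0) hc
  exact this hf

theorem projB_factorB_y : projB (factorB Letter.y) = 0 :=
  congrArg germ (funext fun p => projTp_geom p)

/-- The first correction term in the shuffle relation. -/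
theorem projB_mul_letterOp_mem {a : Letter} {u v : List Letter} (hu : Good (a :: u)) (hv : Good v) :
    projB (factorB a * liB u) * integB (liB v) ∈
      Rab (u.length + (v.length + 1)) (u.length + v.length) := by
  rcases good_cons hu with ⟨rfl, rfl⟩ | ⟨hu0, hgu⟩
  -- Here the word is `y` alone, and `geom` has no exponent divisible by `p`.
  · rw [liB_nil, mul_one, projB_factorB_y, zero_mul]
    exact Submodule.zero_mem _
  · have h1 : projB (factorB a * liB u) ∈ Rab u.length 0 := by
      cases a with
      | x =>
        -- The remaining word is nonempty, so its polylogarithm is itself an integral and has zero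
        -- projection.
        obtain ⟨b, u, rfl⟩ := List.exists_cons_of_ne_nil hu0
        rw [factorB_x, one_mul, liB_cons, letterOp_apply, projB_integB]
        exact Submodule.zero_mem _
      | y => exact projB_factorB_mul_mem (liB_mem_truncSpan hgu hu0)
    have h2 : integB (liB v) ∈ Rab (v.length + 1) (v.length + 1) := by
      rw [← letterOp_x]
      exact letterOp_mem_Rab _ (liB_mem_Rab hv)
    -- The product lies in second degree `v.length + 1`, which is at most `u.length + v.length`
    -- because `u` is nonempty.
    have := List.length_pos_of_ne_nil hu0
    exact Rab_mono (by omega) (Rab_zero_mul h1 h2)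

/-! ### The shuffle relation modulo lower terms -/

theorem linearCombination_liB_prepend (a : Letter) (f : List Letter →₀ ℚ) :
    Finsupp.linearCombination ℚ liB (prepend a f) =
      letterOp a (Finsupp.linearCombination ℚ liB f) := by
  induction f using Finsupp.induction_linear with
  | zero => simp
  | add f g hf hg => simp only [map_add, hf, hg]
  | single k c =>
    rw [prepend_single, Finsupp.linearCombination_single, Finsupp.linearCombination_single,
      map_smul, liB_cons]

theorem letterOp_mem_RabPred (a : Letter) {n : ℕ} {f : B} (hf : f ∈ RabPred n n) :
    letterOp a f ∈ RabPred (n + 1) (n + 1) := by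
  cases n with
  | zero =>
    have : f = 0 := by simpa [RabPred] using hf
    rw [this, map_zero]
    exact Submodule.zero_mem _
  | succ n => exact letterOp_mem_Rab a hf

theorem Good.tail {a : Letter} {w : List Letter} (h : Good (a :: w)) : Good w := by
  rcases good_cons h with ⟨rfl, -⟩ | ⟨-, h⟩
  · exact Or.inl rfl
  · exact h

/-- Integration by parts reproduces the recursion of the shuffle product. `letterOp` raises both
degrees by one, so the inductive errors stay lower terms, and the corrections are lower terms
because their projections lie in second degree `0`. -/
theorem liB_mul_liB (u v : List Letter) (hu : Good u) (hv : Good v) :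
    liB u * liB v - Finsupp.linearCombination ℚ liB (shuffleWord u v) ∈
      RabPred (u.length + v.length) (u.length + v.length) := by
  induction u, v using shuffleWord.induct with
  | case1 w => simp [shuffleWord_nil_left, liB_nil]
  | case2 a u => simp [shuffleWord_nil_right, liB_nil]
  | case3 a u b v ih1 ih2 =>
    have h1 := letterOp_mem_RabPred a (ih1 hu.tail hv)
    have h2 := letterOp_mem_RabPred b (ih2 hu hv.tail)
    have h3 := projB_mul_letterOp_mem hu hv
    have h4 := projB_mul_letterOp_mem hv hu
    have h5 := projB_liB_mul_liB (List.cons_ne_nil _ _) (List.cons_ne_nil _ _) hu hv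
    -- The integrands are chosen so that the two integrals are `liB (a :: u)` and `liB (b :: v)`.
    have key := integB_mul_integB (factorB a * liB u) (factorB b * liB v)
    rw [← letterOp_apply, ← letterOp_apply, ← liB_cons, ← liB_cons,
      mul_assoc (factorB a), mul_left_comm (liB (a :: u)),
      ← letterOp_apply, ← letterOp_apply] at key
    rw [shuffleWord_cons, map_add, linearCombination_liB_prepend, linearCombination_liB_prepend]
    rw [map_sub] at h1 h2
    simp only [List.length_cons] at *
    have e1 : u.length + 1 + (v.length + 1) = u.length + v.length + 1 + 1 := by omega
    rw [show u.length + (v.length + 1) + 1 = u.length + v.length + 1 + 1 by omega] at h1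
    rw [show u.length + 1 + v.length + 1 = u.length + v.length + 1 + 1 by omega] at h2
    rw [show u.length + (v.length + 1 + 1) = u.length + v.length + 1 + 1 by omega] at h3
    rw [show v.length + (u.length + 1 + 1) = u.length + v.length + 1 + 1 by omega] at h4
    rw [e1] at h5 ⊢
    change _ ∈ Rab (u.length + v.length + 1 + 1) (u.length + v.length + 1)
    have h3 := Rab_mono (b' := u.length + v.length + 1) (by omega) h3
    have h4 := Rab_mono (b' := u.length + v.length + 1) (by omega) h4
    have h5 := Rab_mono (Nat.zero_le (u.length + v.length + 1)) h5
    have h6 := Submodule.add_mem _ (Submodule.sub_mem _ (Submodule.sub_mem _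
      (Submodule.add_mem _ h1 h2) h3) h4) h5
    refine (congrArg (· ∈ Rab _ _) ?_).mpr h6
    linear_combination key

/-- The shuffle relation for finite multiple polylogarithms. -/
theorem li_mul_li (k l : Index) :
    li k * li l - Finsupp.linearCombination ℚ li (shuffle k l) ∈
      RabPred (wt k + wt l) (wt k + wt l) := by
  have h := liB_mul_liB _ _ (good_indexWord k) (good_indexWord l)
  rw [← mapDomain_shuffle, Finsupp.linearCombination_mapDomain, length_indexWord,
    length_indexWord, ← li_eq_liB, ← li_eq_liB] at h
  have e : liB ∘ indexWord = li := funext fun k => (li_eq_liB k).symm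
  rwa [e] at h

/-! ### The graded algebra -/

theorem RabPred_le (a b : ℕ) : RabPred a b ≤ Rab a b := by
  cases b with
  | zero => exact bot_le
  | succ b => exact Rab_mono (Nat.le_succ b)

theorem linearCombination_li_mem {f : Index →₀ ℚ} {b : ℕ} (hf : ∀ k ∈ f.support, wt k = b) :
    Finsupp.linearCombination ℚ li f ∈ Rab b b :=
  linearCombination_mem _ _ _ fun k hk => by
    have := liB_mem_Rab (good_indexWord k)
    rwa [length_indexWord, ← li_eq_liB, hf k hk] at this

theorem li_mul_li_mem (k l : Index) : li k * li l ∈ Rab (wt k + wt l) (wt k + wt l) := by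
  have h1 := RabPred_le _ _ (li_mul_li k l)
  have h2 := linearCombination_li_mem (wt_of_mem_support_shuffle k l)
  have := Submodule.add_mem _ h1 h2
  rwa [sub_add_cancel] at this

/-- The filtration by the spaces `ℛ_{a,b}` is multiplicative. -/
theorem filtrationMul : FiltrationMul := by
  intro a₁ b₁ a₂ b₂ _ _ f hf g hg
  have h := Submodule.mul_mem_mul hf hg
  rw [Rab, Rab, Submodule.span_mul_span] at h
  refine Submodule.span_le.mpr ?_ h
  rintro _ ⟨_, ⟨k, k', n, hk, hk', rfl⟩, _, ⟨l, l', m, hl, hl', rfl⟩, rfl⟩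
  have e : constB (zetaA k) * Tp ^ n * li k' * (constB (zetaA l) * Tp ^ m * li l') =
      constB (zetaA k * zetaA l) * Tp ^ (n + m) * (li k' * li l') := by
    rw [map_mul, pow_add]; ring
  rw [SetLike.mem_coe]
  beta_reduce
  rw [e]
  exact coeff_mul_mem_Rab (zetaSpan_mul (zetaA_mem k) (zetaA_mem l)) _
    (Rab_mono (by omega) (li_mul_li_mem k' l')) (by omega)

/-! ### Multiplicativity of `phi` -/

theorem u_mul_u (k l : Index) : StuffleAlg.u k * StuffleAlg.u l =
    Finsupp.linearCombination ℚ StuffleAlg.u (stuffle k l) := by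
  have h1 : ∀ f : Index →₀ ℚ, Finsupp.linearCombination ℚ StuffleAlg.u f =
      StuffleAlg.u.repr.symm f := fun f => (Module.Basis.repr_symm_apply _ f).symm
  rw [h1]
  exact bilin_single stuffle k l

theorem v_mul_v (k l : Index) : ShuffleAlg.v k * ShuffleAlg.v l =
    Finsupp.linearCombination ℚ ShuffleAlg.v (shuffle k l) := by
  have h1 : ∀ f : Index →₀ ℚ, Finsupp.linearCombination ℚ ShuffleAlg.v f =
      ShuffleAlg.v.repr.symm f := fun f => (Module.Basis.repr_symm_apply _ f).symm
  rw [h1]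
  exact bilin_single shuffle k l

/-- The class of an element of `ℛ_{a,b}`, as a linear map to the graded algebra. -/
noncomputable def clsLin (h : FiltrationMul) (i : Bideg) : Rab i.1.1 i.1.2 →ₗ[ℚ] Rbar h :=
  Rbar.of h i ∘ₗ ((RabPred i.1.1 i.1.2).submoduleOf (Rab i.1.1 i.1.2)).mkQ

theorem clsLin_apply (h : FiltrationMul) (i : Bideg) (f : B) (hf : f ∈ Rab i.1.1 i.1.2) :
    clsLin h i ⟨f, hf⟩ = Rbar.of h i (cls i f hf) := rfl

/-- Bidegrees of products agree only propositionally, so the comparison of classes includes the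
transport along `i = j`. -/
theorem clsLin_eq_of_sub_mem (h : FiltrationMul) {i j : Bideg} (hij : i = j) {f g : B}
    (hf : f ∈ Rab i.1.1 i.1.2) (hg : g ∈ Rab j.1.1 j.1.2) (hfg : f - g ∈ RabPred i.1.1 i.1.2) :
    clsLin h i ⟨f, hf⟩ = clsLin h j ⟨g, hg⟩ := by
  subst hij
  rw [clsLin_apply, clsLin_apply, (cls_eq_iff i f g hf hg).mpr hfg]

theorem clsLin_mul (h : FiltrationMul) (i j : Bideg) (f g : B) (hf : f ∈ Rab i.1.1 i.1.2)
    (hg : g ∈ Rab j.1.1 j.1.2) :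
    clsLin h i ⟨f, hf⟩ * clsLin h j ⟨g, hg⟩ = clsLin h (i + j) ⟨f * g, mul_mem_Rab h i j hf hg⟩ := by
  -- The graded ring structure depends on the proof `h` and is not a global instance.
  let := pieceRing h
  exact DirectSum.of_mul_of (A := Piece) (cls i f hf) (cls j g hg)

theorem clsLin_one (h : FiltrationMul) : clsLin h 0 ⟨1, one_mem_Rab⟩ = 1 := rfl

theorem phi_uv (h : FiltrationMul) (k l : Index) :
    phi h (StuffleAlg.u k ⊗ₜ ShuffleAlg.v l) =
      clsLin h (bideg k l) ⟨constB (zetaA k) * li l, zeta_mul_li_mem k l⟩ := by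
  have : StuffleAlg.u k ⊗ₜ ShuffleAlg.v l = uv (k, l) :=
    (Module.Basis.tensorProduct_apply _ _ k l).symm
  rw [this, phi, Module.Basis.constr_basis]
  rfl

theorem zeta_mul_li_linearCombination_mem {f g : Index →₀ ℚ} {i : Bideg}
    (hf : ∀ k ∈ f.support, ∀ l ∈ g.support, bideg k l = i) :
    constB (Finsupp.linearCombination ℚ zetaA f) * Finsupp.linearCombination ℚ li g ∈
      Rab i.1.1 i.1.2 := by
  change constLin (Finsupp.linearCombination ℚ zetaA f) * _ ∈ _
  rw [Finsupp.linearCombination_apply, Finsupp.linearCombination_apply, Finsupp.sum, Finsupp.sum,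
    map_sum, Finset.sum_mul_sum]
  refine Submodule.sum_mem _ fun k hk => Submodule.sum_mem _ fun l hl => ?_
  rw [map_smul, smul_mul_smul_comm, ← hf k hk l hl]
  exact Submodule.smul_mem _ _ (zeta_mul_li_mem k l)

-- A linear combination homogeneous in bidegree maps to a single graded piece, where the sum of
-- classes is the class of the sum. The sums run over `attach`, since membership in `ℛ_{a,b}` of
-- each term relies on its indices lying in the supports.
set_option synthInstance.maxHeartbeats 400000 in
theorem phi_linearCombination (h : FiltrationMul) {f g : Index →₀ ℚ} {i : Bideg}
    (hf : ∀ k ∈ f.support, ∀ l ∈ g.support, bideg k l = i) :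
    phi h (Finsupp.linearCombination ℚ StuffleAlg.u f ⊗ₜ Finsupp.linearCombination ℚ ShuffleAlg.v g) =
      clsLin h i ⟨constB (Finsupp.linearCombination ℚ zetaA f) * Finsupp.linearCombination ℚ li g,
        zeta_mul_li_linearCombination_mem hf⟩ := by
  classical
  have e : (⟨constB (Finsupp.linearCombination ℚ zetaA f) * Finsupp.linearCombination ℚ li g,
        zeta_mul_li_linearCombination_mem hf⟩ : Rab i.1.1 i.1.2) =
      ∑ k ∈ f.support.attach, ∑ l ∈ g.support.attach, (f k * g l) •
        (⟨constB (zetaA k) * li l, hf k k.2 l l.2 ▸ zeta_mul_li_mem k l⟩ : Rab i.1.1 i.1.2) := by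
    apply Subtype.ext
    simp only [Submodule.coe_sum, Submodule.coe_smul]
    change constLin (Finsupp.linearCombination ℚ zetaA f) * _ = _
    rw [Finsupp.linearCombination_apply, Finsupp.linearCombination_apply, Finsupp.sum,
      Finsupp.sum, map_sum, Finset.sum_mul_sum, ← Finset.sum_attach f.support]
    refine Finset.sum_congr rfl fun k _ => ?_
    rw [← Finset.sum_attach g.support]
    refine Finset.sum_congr rfl fun l _ => ?_
    rw [map_smul, smul_mul_smul_comm]
    rfl
  rw [e, Finsupp.linearCombination_apply, Finsupp.linearCombination_apply, Finsupp.sum, Finsupp.sum,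
    TensorProduct.sum_tmul, map_sum, map_sum, ← Finset.sum_attach f.support]
  refine Finset.sum_congr rfl fun k _ => ?_
  rw [TensorProduct.tmul_sum, map_sum, map_sum, ← Finset.sum_attach g.support]
  refine Finset.sum_congr rfl fun l _ => ?_
  rw [TensorProduct.smul_tmul_smul, map_smul, map_smul, phi_uv]
  congr 1
  exact clsLin_eq_of_sub_mem h (hf k k.2 l l.2) _ _ (by rw [sub_self]; exact Submodule.zero_mem _)

theorem bideg_add (k l k' l' : Index) {m n : Index} (hm : wt m = wt k + wt k')
    (hn : wt n = wt l + wt l') : bideg m n = bideg k l + bideg k' l' := by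
  apply Subtype.ext
  change (wt m + wt n, wt n) = (wt k + wt l + (wt k' + wt l'), wt l + wt l')
  rw [hm, hn]
  congr 1
  omega

theorem phi_mul_uv (h : FiltrationMul) (k l k' l' : Index) :
    phi h ((StuffleAlg.u k ⊗ₜ ShuffleAlg.v l) * (StuffleAlg.u k' ⊗ₜ ShuffleAlg.v l')) =
      phi h (StuffleAlg.u k ⊗ₜ ShuffleAlg.v l) * phi h (StuffleAlg.u k' ⊗ₜ ShuffleAlg.v l') := by
  rw [Algebra.TensorProduct.tmul_mul_tmul, u_mul_u, v_mul_v,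
    phi_linearCombination h (i := bideg k l + bideg k' l') (fun m hm n hn =>
      bideg_add k l k' l' (wt_of_mem_support_stuffle k k' m hm)
        (wt_of_mem_support_shuffle l l' n hn)),
    phi_uv, phi_uv, clsLin_mul]
  refine clsLin_eq_of_sub_mem h rfl _ _ ?_
  rw [← zetaA_mul]
  -- The stuffle relation is exact, so the discrepancy is the zeta product times the error in the
  -- shuffle relation.
  have e : constB (zetaA k * zetaA k') * Finsupp.linearCombination ℚ li (shuffle l l') -
      constB (zetaA k) * li l * (constB (zetaA k') * li l') =
      -(constB (zetaA k * zetaA k') * Tp ^ 0 *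
        (li l * li l' - Finsupp.linearCombination ℚ li (shuffle l l'))) := by
    rw [map_mul, pow_zero]; ring
  rw [e]
  refine Submodule.neg_mem _ ?_
  have h1 := li_mul_li l l'
  have hz := zetaSpan_mul (zetaA_mem k) (zetaA_mem k')
  change _ ∈ RabPred (wt k + wt l + (wt k' + wt l')) (wt l + wt l')
  generalize li l * li l' - Finsupp.linearCombination ℚ li (shuffle l l') = x at h1
  -- In second degree `0` the lower space is zero and the shuffle error vanishes; otherwise it is a
  -- genuine `ℛ_{a,b-1}`, stable under zeta coefficients.
  generalize hb : wt l + wt l' = b at h1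
  cases b with
  | zero =>
    have : x = 0 := by simpa [RabPred] using h1
    rw [this, mul_zero]
    exact Submodule.zero_mem _
  | succ b => exact coeff_mul_mem_Rab hz 0 h1 (by omega)

theorem phi_mul (h : FiltrationMul) (x y : StuffleShuffle) : phi h (x * y) = phi h x * phi h y := by
  have h1 : (LinearMap.mul ℚ StuffleShuffle).compr₂ (phi h) =
      (LinearMap.mul ℚ (Rbar h)).compl₁₂ (phi h) (phi h) := by
    refine uv.ext fun k => uv.ext fun l => ?_
    have e : ∀ k : Index × Index, uv k = StuffleAlg.u k.1 ⊗ₜ ShuffleAlg.v k.2 :=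
      fun k => Module.Basis.tensorProduct_apply _ _ k.1 k.2
    rw [e, e]
    exact phi_mul_uv h k.1 k.2 l.1 l.2
  exact LinearMap.congr_fun₂ h1 x y

theorem phi_one (h : FiltrationMul) : phi h 1 = 1 := by
  have e : (1 : StuffleShuffle) = StuffleAlg.u [] ⊗ₜ ShuffleAlg.v [] := rfl
  rw [e, phi_uv, ← clsLin_one]
  refine clsLin_eq_of_sub_mem h rfl _ _ ?_
  rw [zetaA_nil, li_nil, map_one, mul_one, sub_self]
  exact Submodule.zero_mem _

end FMP

theorem mainTheorem5 :
    ∃ h : FMP.FiltrationMul, ∃ Φ : FMP.StuffleShuffle →ₐ[ℚ] FMP.Rbar h,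
      Φ.toLinearMap = FMP.phi h :=
  ⟨FMP.filtrationMul, AlgHom.ofLinearMap (FMP.phi _) (FMP.phi_one _) (FMP.phi_mul _), rfl⟩
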